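/- Let $\mathsf h$ be a finite-dimensional Hilbert space with a fixed orthonormal basis $(e_j)_j$; operators on $\mathsf h$ are identified with their matrices in this basis, $x^{\intercal}$ is the transpose in this basis, and $\mathcal B(\mathsf h)$ is the algebra of all operators. Let $H_S=\sum_j\varepsilon_j|e_j\rangle\langle e_j|$ with $\varepsilon_j\in\mathbb R$ (not necessarily distinct), and let $P_a$ be the orthogonal projection onto $\ker(H_S-a)$. A Bohr frequency is a number $\omega=a-b>0$ with $a,b$ eigenvalues of $H_S$. Let $V\in\mathcal B(\mathsf h)$ and, for each Bohr frequency $\omega$, put $$V_\omega=\sum_{a-b=\omega}P_b\,V\,P_a ,$$ the sum being over pairs of eigenvalues of $H_S$. Let $\gamma^-_\omega,\gamma^+_\omega>0$, let $H_\omega$ be a self-adjoint operator commuting with $H_S$, and assume that $V_\omega$ and $H_\omega$ are real matrices for every Bohr frequency $\omega$. Let $\mathcal T_t=e^{t\mathcal L}$ be the quantum Markov semigroup with generator $\mathcal L=\sum_\omega\mathcal L_\omega$, where $$\mathcal L_\omega(x)=i[H_\omega,x]-\tfrac{\gamma^-_\omega}{2}\left(V_\omega^*V_\omega x-2V_\omega^*xV_\omega+xV_\omega^*V_\omega\right)-\tfrac{\gamma^+_\omega}{2}\left(V_\omega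 V_\omega^*x-2V_\omega xV_\omega^*+xV_\omega V_\omega^*\right).$$ Let $\rho=\sum_j\rho_j|e_j\rangle\langle e_j|$, with $\rho_j>0$ and $\sum_j\rho_j=1$, be the density of a faithful state that is invariant, i.e. $\mathrm{tr}(\rho\,\mathcal T_t(x))=\mathrm{tr}(\rho x)$ for all $t\ge0$ and all $x$. Define the forward and backward two-point states on $\mathcal B(\mathsf h)\otimes\mathcal B(\mathsf h)=\mathcal B(\mathsf h\otimes\mathsf h)$ by $$\overrightarrow\Omega_t(x\otimes y)=\mathrm{tr}\left(\rho^{1/2}x^{\intercal}\rho^{1/2}\,\mathcal T_t(y)\right),\qquad \overleftarrow\Omega_t(x\otimes y)=\mathrm{tr}\left(\rho^{1/2}\,\mathcal T_t(x)^{\intercal}\rho^{1/2}\,y\right),$$ and the entropy production $$\mathrm{ep}(\mathcal T,\rho)=\limsup_{t\to0^+}\frac{S(\overrightarrow\Omega_t,\overleftarrow\Omega_t)}{t}\in[0,+\infty],$$ where the relative entropy of states with densities $A,B$ is $S(A,B)=\mathrm{Tr}\left(A(\log A-\log B)\right)$ if $\ker B\subseteq\ker A$ (logarithms taken on the supports)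 and $S(A,B)=+\infty$ otherwise. For each Bohr frequency $\omega$ put $$\nu^-_\omega=\mathrm{tr}(\rho V_\omega^*V_\omega),\qquad \nu^+_\omega=\mathrm{tr}(\rho V_\omega V_\omega^*),\qquad \mu_\omega=\mathrm{tr}(\rho^{1/2}V_\omega^*\rho^{1/2}V_\omega).$$ Then $\mathrm{ep}(\mathcal T,\rho)=0$ if and only if, for every Bohr frequency $\omega$, $$\gamma^-_\omega\nu^-_\omega=\gamma^+_\omega\nu^+_\omega\qquad\text{and}\qquad \nu^-_\omega\nu^+_\omega=\mu_\omega^2 .$$ -/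

import Mathlib

open Matrix Filter Topology
open scoped Kronecker

noncomputable section

namespace StochasticLimit

variable {ι : Type*} [Fintype ι] [DecidableEq ι]

/-! Operators on a finite-dimensional Hilbert space with a fixed orthonormal basis `(e_j)`, `j : ι`,
are written as matrices in that basis. The system Hamiltonian `H_S` is diagonal, with
(not necessarily distinct) eigenvalues `ε j`. -/

/-- The system Hamiltonian `H_S = ∑ j, ε_j |e_j⟩⟨e_j|`. -/
def systemHamiltonian (ε : ι → ℝ) : Matrix ι ι ℂ :=
  diagonal fun j => (ε j : ℂ)

/-- The orthogonal projection `P_a` onto the nullspace of `H_S - a`. -/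
def spectralProjection (ε : ι → ℝ) (a : ℝ) : Matrix ι ι ℂ :=
  diagonal fun j => if ε j = a then 1 else 0

/-- The (finite) spectrum of `H_S`. -/
def energies (ε : ι → ℝ) : Finset ℝ :=
  Finset.univ.image ε

/-- The Bohr frequencies: the strictly positive differences of eigenvalues of `H_S`. -/
def bohrFrequencies (ε : ι → ℝ) : Finset ℝ :=
  ((energies ε ×ˢ energies ε).image fun q => q.1 - q.2).filter fun ω => 0 < ω

/-- `V_ω = ∑ P_b V P_a`, the sum over the pairs of eigenvalues `a, b` of `H_S`
with `a - b = ω`. -/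
def bohrComponent (ε : ι → ℝ) (V : Matrix ι ι ℂ) (ω : ℝ) : Matrix ι ι ℂ :=
  ∑ q ∈ (energies ε ×ˢ energies ε).filter fun q => q.1 - q.2 = ω,
    spectralProjection ε q.2 * V * spectralProjection ε q.1

/-- The map
`x ↦ i[H,x] - (γ⁻/2)(W*W x - 2 W* x W + x W*W) - (γ⁺/2)(W W* x - 2 W x W* + x W W*)`. -/
def localGenerator (H W : Matrix ι ι ℂ) (γm γp : ℝ) :
    Matrix ι ι ℂ →ₗ[ℂ] Matrix ι ι ℂ where
  toFun x := Complex.I • (H * x - x * H)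
    - ((γm : ℂ) / 2) • (Wᴴ * W * x - (2 : ℂ) • (Wᴴ * x * W) + x * (Wᴴ * W))
    - ((γp : ℂ) / 2) • (W * Wᴴ * x - (2 : ℂ) • (W * x * Wᴴ) + x * (W * Wᴴ))
  map_add' x y := by
    simp only [Matrix.mul_add, Matrix.add_mul, smul_add, smul_sub]
    abel
  map_smul' c x := by
    simp only [Matrix.mul_smul, Matrix.smul_mul, smul_add, smul_sub, smul_comm _ c,
      RingHom.id_apply]

/-- The generator `𝓛 = ∑_ω 𝓛_ω`, summed over the Bohr frequencies. -/
def generator (ε : ι → ℝ) (V : Matrix ι ι ℂ) (H : ℝ → Matrix ι ι ℂ) (γm γp : ℝ → ℝ) :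
    Matrix ι ι ℂ →ₗ[ℂ] Matrix ι ι ℂ :=
  ∑ ω ∈ bohrFrequencies ε, localGenerator (H ω) (bohrComponent ε V ω) (γm ω) (γp ω)

/-- The semigroup `T_t = exp (t L)` generated by a linear map `L` on matrices: the exponential
is the one of matrices, applied to the matrix of `t L` in the basis of matrix units. -/
def semigroup (L : Matrix ι ι ℂ →ₗ[ℂ] Matrix ι ι ℂ) (t : ℝ) :
    Matrix ι ι ℂ →ₗ[ℂ] Matrix ι ι ℂ :=
  Matrix.toLin (Matrix.stdBasis ℂ ι ι) (Matrix.stdBasis ℂ ι ι)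
    (NormedSpace.exp ((t : ℂ) •
      LinearMap.toMatrix (Matrix.stdBasis ℂ ι ι) (Matrix.stdBasis ℂ ι ι) L))

/-- The density `ρ = ∑ j, ρ_j |e_j⟩⟨e_j|`. -/
def density (p : ι → ℝ) : Matrix ι ι ℂ :=
  diagonal fun j => (p j : ℂ)

/-- The square root `ρ^{1/2} = ∑ j, ρ_j^{1/2} |e_j⟩⟨e_j|`. -/
def sqrtDensity (p : ι → ℝ) : Matrix ι ι ℂ :=
  diagonal fun j => (Real.sqrt (p j) : ℂ)

/-- The state with density `ρ` is invariant: `tr (ρ T_t(x)) = tr (ρ x)` for all `x`, `t ≥ 0`. -/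
def IsInvariant (T : ℝ → Matrix ι ι ℂ →ₗ[ℂ] Matrix ι ι ℂ) (p : ι → ℝ) : Prop :=
  ∀ t : ℝ, 0 ≤ t → ∀ x : Matrix ι ι ℂ, trace (density p * T t x) = trace (density p * x)

/-- The forward two-point state `x ⊗ y ↦ tr (ρ^{1/2} xᵀ ρ^{1/2} T_t(y))`. -/
def forwardState (T : ℝ → Matrix ι ι ℂ →ₗ[ℂ] Matrix ι ι ℂ) (p : ι → ℝ) (t : ℝ) :
    Matrix ι ι ℂ →ₗ[ℂ] Matrix ι ι ℂ →ₗ[ℂ] ℂ :=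
  LinearMap.mk₂ ℂ (fun x y => trace (sqrtDensity p * xᵀ * sqrtDensity p * T t y))
    (by intros; simp [Matrix.mul_add, Matrix.add_mul])
    (by intros; simp)
    (by intros; simp [Matrix.mul_add])
    (by intros; simp)

/-- The backward two-point state `x ⊗ y ↦ tr (ρ^{1/2} T_t(x)ᵀ ρ^{1/2} y)`. -/
def backwardState (T : ℝ → Matrix ι ι ℂ →ₗ[ℂ] Matrix ι ι ℂ) (p : ι → ℝ) (t : ℝ) :
    Matrix ι ι ℂ →ₗ[ℂ] Matrix ι ι ℂ →ₗ[ℂ] ℂ :=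
  LinearMap.mk₂ ℂ (fun x y => trace (sqrtDensity p * (T t x)ᵀ * sqrtDensity p * y))
    (by intros; simp [Matrix.mul_add, Matrix.add_mul])
    (by intros; simp)
    (by intros; simp [Matrix.mul_add])
    (by intros; simp)

/-- The density matrix, in the product basis, of the functional on `B(h) ⊗ B(h) = B(h ⊗ h)`
given by a bilinear form `Ω`. See `trace_twoPointDensity_mul`. -/
def twoPointDensity (Ω : Matrix ι ι ℂ →ₗ[ℂ] Matrix ι ι ℂ →ₗ[ℂ] ℂ) :
    Matrix (ι × ι) (ι × ι) ℂ :=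
  Matrix.of fun a b => Ω (Matrix.single b.1 a.1 1) (Matrix.single b.2 a.2 1)

/-- `twoPointDensity Ω` is the matrix `D` with `tr (D (x ⊗ y)) = Ω(x ⊗ y)`. -/
theorem trace_twoPointDensity_mul (Ω : Matrix ι ι ℂ →ₗ[ℂ] Matrix ι ι ℂ →ₗ[ℂ] ℂ)
    (x y : Matrix ι ι ℂ) : trace (twoPointDensity Ω * (x ⊗ₖ y)) = Ω x y := by
  conv_rhs => rw [Matrix.matrix_eq_sum_single x, Matrix.matrix_eq_sum_single y]
  have hs : ∀ (i j : ι) (c : ℂ), Matrix.single i j c = c • Matrix.single i j (1 : ℂ) := by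
    intro i j c; simp
  simp only [map_sum, LinearMap.sum_apply]
  simp_rw [fun i j => hs i j (x i j), fun i j => hs i j (y i j)]
  simp only [map_smul, LinearMap.smul_apply, smul_eq_mul, Matrix.trace, Matrix.diag_apply,
    Matrix.mul_apply, twoPointDensity, Matrix.of_apply, Matrix.kroneckerMap_apply,
    Fintype.sum_prod_type]
  have e : ∀ F : ι → ι → ι → ι → ℂ,
      (∑ a, ∑ b, ∑ c, ∑ d, F a b c d) = ∑ d, ∑ b, ∑ c, ∑ a, F a b c d := by
    intro F
    calc (∑ a, ∑ b, ∑ c, ∑ d, F a b c d)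
        = ∑ a, ∑ b, ∑ d, ∑ c, F a b c d :=
          Finset.sum_congr rfl fun a _ => Finset.sum_congr rfl fun b _ => Finset.sum_comm
      _ = ∑ a, ∑ d, ∑ b, ∑ c, F a b c d :=
          Finset.sum_congr rfl fun a _ => Finset.sum_comm
      _ = ∑ d, ∑ a, ∑ b, ∑ c, F a b c d := Finset.sum_comm
      _ = ∑ d, ∑ b, ∑ a, ∑ c, F a b c d :=
          Finset.sum_congr rfl fun d _ => Finset.sum_comm
      _ = _ :=
          Finset.sum_congr rfl fun d _ => Finset.sum_congr rfl fun b _ => Finset.sum_comm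
  rw [e]
  refine Finset.sum_congr rfl fun a _ => Finset.sum_congr rfl fun b _ =>
    Finset.sum_congr rfl fun c _ => Finset.sum_congr rfl fun d _ => ?_
  ring

/-- Relative entropy `S(A, B) = Tr (A (log A - log B))` of positive semidefinite matrices,
equal to `+∞` unless the kernel of `B` is contained in the kernel of `A`. The functional calculus
uses `Real.log 0 = 0`, that is, logarithms are taken on the supports. -/
def relativeEntropy {κ : Type*} [Fintype κ] [DecidableEq κ] (A B : Matrix κ κ ℂ) : EReal :=
  open scoped Classical in
  if ∀ v : κ → ℂ, B *ᵥ v = 0 → A *ᵥ v = 0 then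
    ((trace (A * (cfc Real.log A - cfc Real.log B))).re : EReal)
  else ⊤

/-- The entropy production `limsup_{t → 0+} S(forward state at t, backward state at t) / t`. -/
def entropyProduction (T : ℝ → Matrix ι ι ℂ →ₗ[ℂ] Matrix ι ι ℂ) (p : ι → ℝ) : EReal :=
  limsup
    (fun t : ℝ => relativeEntropy (twoPointDensity (forwardState T p t))
      (twoPointDensity (backwardState T p t)) / (t : EReal))
    (𝓝[>] (0 : ℝ))

/-- `ν⁻ = tr (ρ W* W)`. -/
def nuMinus (p : ι → ℝ) (W : Matrix ι ι ℂ) : ℂ := trace (density p * Wᴴ * W)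

/-- `ν⁺ = tr (ρ W W*)`. -/
def nuPlus (p : ι → ℝ) (W : Matrix ι ι ℂ) : ℂ := trace (density p * W * Wᴴ)

/-- `μ = tr (ρ^{1/2} W* ρ^{1/2} W)`. -/
def mu (p : ι → ℝ) (W : Matrix ι ι ℂ) : ℂ :=
  trace (sqrtDensity p * Wᴴ * sqrtDensity p * W)

/-- All entries of the matrix are real. -/
def IsRealMatrix (A : Matrix ι ι ℂ) : Prop := ∀ i j, (A i j).im = 0

end StochasticLimit

end

/-! Necessity rests on the bound S(A,B) ≥ ‖√A − √B‖² in Hilbert–Schmidt norm, which gives (√⟨w,Aw⟩ −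
√⟨w,Bw⟩)² ≤ S(A,B)‖w‖² for each single vector w (`sq_sqrt_expectation_sub_le`). At t = 0 both
two-point states are the pure state of Σ √ρ_j e_j ⊗ e_j. For w orthogonal to that vector both
expectations start at 0 and grow linearly, so S = o(t) forces equal slopes
(`derivative_eq_of_entropyProduction_eq_zero`). Taking w from V_ω ρ^{1/2} and from ρ^{1/2} V_ω, the
energy grading leaves a single jump term on each side, and the slopes read γ⁻(ν⁻)² = γ⁺μ² and γ⁻μ² =
γ⁺(ν⁺)².

Conversely, the scalar conditions are an equality case of Cauchy–Schwarz and amount to √γ⁻ V_ω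
ρ^{1/2} = √γ⁺ ρ^{1/2} V_ω (`smul_mul_sqrtDensity_eq`). Each dissipative part is then symmetric for
the form tr(ρ^{1/2} xᵀ ρ^{1/2} y). Invariance now forces Σ H_ω to commute with ρ, so the whole
generator is symmetric, hence so is the semigroup, and the two states coincide.

Complete positivity and symmetry are closed conditions; they pass from the generator to the
semigroup by Chernoff's product formula (`semigroup_induction`). -/

set_option linter.unusedSectionVars false

noncomputable section

/-! ### Chernoff's product formula. -/

section ChernoffProduct

theorem norm_pow_sub_pow_le_mul {𝔸 : Type*} [NormedRing 𝔸] [NormOneClass 𝔸] {x y : 𝔸} {M : ℝ} (hM : 1 ≤ M) (hx : ‖x‖ ≤ M)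
    (hy : ‖y‖ ≤ M) (n : ℕ) : ‖x ^ n - y ^ n‖ ≤ n * M ^ n * ‖x - y‖ := by
  induction n with
  | zero => simp
  | succ n ih =>
    have hM0 : 0 ≤ M := by linarith
    have e : x ^ (n + 1) - y ^ (n + 1) = x ^ n * (x - y) + (x ^ n - y ^ n) * y := by
      rw [pow_succ, pow_succ]; noncomm_ring
    have h1 : ‖x ^ n * (x - y)‖ ≤ M ^ (n + 1) * ‖x - y‖ := by
      refine (norm_mul_le _ _).trans ?_
      gcongr
      exact (norm_pow_le _ _).trans ((pow_le_pow_left₀ (norm_nonneg _) hx n).trans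
        (pow_le_pow_right₀ hM (Nat.le_succ n)))
    have h2 : ‖(x ^ n - y ^ n) * y‖ ≤ n * M ^ n * ‖x - y‖ * M :=
      (norm_mul_le _ _).trans (by gcongr)
    rw [e]
    refine (norm_add_le _ _).trans ((add_le_add h1 h2).trans (le_of_eq ?_))
    push_cast
    ring

variable {𝔸 : Type*} [NormedRing 𝔸] [NormedAlgebra ℝ 𝔸]

theorem HasDerivAt.exists_norm_le_one_add [NormOneClass 𝔸] {F : ℝ → 𝔸} {a : 𝔸}
    (hF : HasDerivAt F a 0) (hF0 : F 0 = 1) :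
    ∃ C : ℝ, 0 ≤ C ∧ ∀ᶠ s in 𝓝 (0 : ℝ), ‖F s‖ ≤ 1 + C * |s| := by
  obtain ⟨C, hC, h⟩ := hF.isBigO_sub.exists_pos
  refine ⟨C, hC.le, ?_⟩
  filter_upwards [h.bound] with s hs
  have : F s = 1 + (F s - F 0) := by rw [hF0]; abel
  rw [this]
  refine (norm_add_le _ _).trans ?_
  rw [norm_one]
  simpa using hs

/-- Chernoff's product formula in a Banach algebra. -/
theorem HasDerivAt.tendsto_pow_exp [NormOneClass 𝔸] [CompleteSpace 𝔸] {F : ℝ → 𝔸} {a : 𝔸}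
    (hF : HasDerivAt F a 0) (hF0 : F 0 = 1) (t : ℝ) :
    Tendsto (fun n : ℕ => F (t / n) ^ n) atTop (𝓝 (NormedSpace.exp (t • a))) := by
  have hE : HasDerivAt (fun s : ℝ => NormedSpace.exp (s • a)) a 0 := by
    simpa using hasDerivAt_exp_smul_const (𝕂 := ℝ) a 0
  have hE0 : NormedSpace.exp ((0 : ℝ) • a) = 1 := by simp
  obtain ⟨C₁, hC₁, h₁⟩ := hF.exists_norm_le_one_add hF0
  obtain ⟨C₂, hC₂, h₂⟩ := hE.exists_norm_le_one_add hE0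
  have hlim : Tendsto (fun n : ℕ => t / n) atTop (𝓝 0) := tendsto_const_div_atTop_nhds_zero_nat t
  -- `F` and the exponential agree to first order at 0, so n factors at t/n accumulate an error n ·
  -- o(1/n).
  have ho : (fun s => F s - NormedSpace.exp (s • a)) =o[𝓝 0] fun s : ℝ => s := by
    have := (hF.sub hE).isLittleO
    simpa [hF0] using this
  set K := max C₁ C₂ with hK
  have hK0 : 0 ≤ K := le_max_of_le_left hC₁
  rw [Metric.tendsto_atTop']
  intro δ hδ
  -- Chosen so that the final error is at most δ/2; the `+ 1` keeps the denominator suitable for the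
  -- estimate when t = 0.
  set c : ℝ := δ / (2 * (Real.exp (K * |t|) * (|t| + 1))) with hc
  have hc0 : 0 < c := by positivity
  have hev := hlim.eventually (h₁.and (h₂.and (ho.bound hc0)))
  obtain ⟨N, hN⟩ := (hev.and (eventually_gt_atTop 0)).exists_forall_of_atTop
  refine ⟨N, fun n hn => ?_⟩
  obtain ⟨⟨b₁, b₂, b₃⟩, hn0⟩ := hN n hn.le
  have hn0' : (0 : ℝ) < n := by exact_mod_cast hn0
  have hexp : NormedSpace.exp (t • a) = NormedSpace.exp ((t / n) • a) ^ n := by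
    let _ : NormedAlgebra ℚ 𝔸 := NormedAlgebra.restrictScalars ℚ ℝ 𝔸
    rw [← NormedSpace.exp_nsmul, ← Nat.cast_smul_eq_nsmul ℝ, smul_smul]
    congr 2
    field_simp
  have habs : |t / n| = |t| / n := by rw [abs_div, abs_of_pos hn0']
  have hM : 1 ≤ 1 + K * |t / n| := by have : 0 ≤ K * |t / n| := by positivity
                                      linarith
  have hMn : (1 + K * |t / n|) ^ n ≤ Real.exp (K * |t|) := by
    have : 1 + K * |t / n| ≤ Real.exp (K * |t / n|) := by
      rw [add_comm]; exact Real.add_one_le_exp _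
    refine (pow_le_pow_left₀ (by linarith) this n).trans (le_of_eq ?_)
    rw [← Real.exp_nat_mul, habs]
    congr 1
    field_simp
  have key := norm_pow_sub_pow_le_mul hM
    (b₁.trans (by gcongr; exact le_max_left _ _)) (b₂.trans (by gcongr; exact le_max_right _ _)) n
  rw [dist_eq_norm, hexp]
  refine key.trans_lt ?_
  calc n * (1 + K * |t / n|) ^ n * ‖F (t / n) - NormedSpace.exp ((t / n) • a)‖
      ≤ n * Real.exp (K * |t|) * (c * (|t| / n)) := by
        rw [← habs]
        gcongr
        exact b₃
    _ = c * (Real.exp (K * |t|) * |t|) := by field_simp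
    _ ≤ c * (Real.exp (K * |t|) * (|t| + 1)) := by gcongr; linarith
    _ < δ := by
        rw [hc]
        have : 0 < Real.exp (K * |t|) * (|t| + 1) := by positivity
        rw [div_mul_eq_mul_div, div_lt_iff₀ (by positivity)]
        nlinarith

end ChernoffProduct

namespace StochasticLimit

variable {ι : Type*} [Fintype ι] [DecidableEq ι]

/-! ### The semigroup as a limit of powers of first-order approximations. -/

section Semigroup

attribute [local instance] Matrix.linftyOpNormedRing Matrix.linftyOpNormedAlgebra

/-- A linear map on matrices with a given matrix in the basis of matrix units. -/
def mapOfMatrix : Matrix (ι × ι) (ι × ι) ℂ ≃ₗ[ℂ] (Matrix ι ι ℂ →ₗ[ℂ] Matrix ι ι ℂ) :=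
  Matrix.toLin (Matrix.stdBasis ℂ ι ι) (Matrix.stdBasis ℂ ι ι)

theorem mapOfMatrix_one : mapOfMatrix (1 : Matrix (ι × ι) (ι × ι) ℂ) = 1 :=
  Matrix.toLin_one _

theorem mapOfMatrix_mul (A B : Matrix (ι × ι) (ι × ι) ℂ) :
    mapOfMatrix (A * B) = mapOfMatrix A * mapOfMatrix B :=
  Matrix.toLin_mul _ _ _ A B

theorem mapOfMatrix_pow (A : Matrix (ι × ι) (ι × ι) ℂ) (n : ℕ) :
    mapOfMatrix (A ^ n) = mapOfMatrix A ^ n := by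
  induction n with
  | zero => simp [mapOfMatrix_one]
  | succ n ih => rw [pow_succ, mapOfMatrix_mul, ih, pow_succ]

theorem semigroup_eq (L : Matrix ι ι ℂ →ₗ[ℂ] Matrix ι ι ℂ) (t : ℝ) :
    semigroup L t = mapOfMatrix (NormedSpace.exp (t • mapOfMatrix.symm L)) := by
  rw [← Complex.coe_smul]
  rfl

theorem semigroup_zero (L : Matrix ι ι ℂ →ₗ[ℂ] Matrix ι ι ℂ) : semigroup L 0 = 1 := by
  rw [semigroup_eq, zero_smul, NormedSpace.exp_zero, mapOfMatrix_one]

theorem hasDerivAt_semigroup (L : Matrix ι ι ℂ →ₗ[ℂ] Matrix ι ι ℂ)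
    (φ : (Matrix ι ι ℂ →ₗ[ℂ] Matrix ι ι ℂ) →ₗ[ℂ] ℂ) :
    HasDerivAt (fun t : ℝ => φ (semigroup L t)) (φ L) 0 := by
  have h := hasDerivAt_exp_smul_const (𝕂 := ℝ) (mapOfMatrix.symm L) (0 : ℝ)
  have hφ := (LinearMap.toContinuousLinearMap
    ((φ ∘ₗ mapOfMatrix.toLinearMap).restrictScalars ℝ)).hasFDerivAt.comp_hasDerivAt (0 : ℝ) h
  have e : φ L = (LinearMap.toContinuousLinearMap
      ((φ ∘ₗ mapOfMatrix.toLinearMap).restrictScalars ℝ))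
      (NormedSpace.exp ((0 : ℝ) • mapOfMatrix.symm L) * mapOfMatrix.symm L) := by
    simp only [zero_smul, NormedSpace.exp_zero, one_mul]
    change φ L = φ (mapOfMatrix (mapOfMatrix.symm L))
    rw [LinearEquiv.apply_symm_apply]
  simp only [semigroup_eq]
  rw [e]
  exact hφ

/-- A closed property of linear maps which holds for the powers of
`1 + s L + s² K`, `s ≥ 0`, holds for the semigroup generated by `L`. -/
theorem semigroup_induction [Nonempty ι] (L K : Matrix ι ι ℂ →ₗ[ℂ] Matrix ι ι ℂ)
    (P : (Matrix ι ι ℂ →ₗ[ℂ] Matrix ι ι ℂ) → Prop)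
    (hP : IsClosed {A : Matrix (ι × ι) (ι × ι) ℂ | P (mapOfMatrix A)})
    (h : ∀ s : ℝ, 0 ≤ s → ∀ n : ℕ, P ((1 + (s : ℂ) • L + ((s ^ 2 : ℝ) : ℂ) • K) ^ n))
    (t : ℝ) (ht : 0 ≤ t) : P (semigroup L t) := by
  set a := mapOfMatrix.symm L
  set b := mapOfMatrix.symm K
  have hF : HasDerivAt (fun s : ℝ => 1 + s • a + s ^ 2 • b) a 0 := by
    have h1 : HasDerivAt (fun s : ℝ => s • a) ((1 : ℝ) • a) 0 := (hasDerivAt_id 0).smul_const a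
    have h2 : HasDerivAt (fun s : ℝ => s ^ 2 • b) (((2 : ℕ) * (0 : ℝ) ^ 1 : ℝ) • b) 0 :=
      (hasDerivAt_pow 2 0).smul_const b
    refine HasDerivAt.congr_deriv ((h1.const_add 1).add h2) ?_
    simp
  have hlim := hF.tendsto_pow_exp (by simp) t
  rw [semigroup_eq]
  refine hP.mem_of_tendsto hlim (Eventually.of_forall fun n => ?_)
  have := h (t / n) (by positivity) n
  rw [Set.mem_ofPred_eq, mapOfMatrix_pow]
  convert this using 2
  simp only [map_add, mapOfMatrix_one, ← Complex.coe_smul, map_smul, a, b,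
    LinearEquiv.apply_symm_apply]

theorem continuous_mapOfMatrix_apply (φ : (Matrix ι ι ℂ →ₗ[ℂ] Matrix ι ι ℂ) →ₗ[ℂ] ℂ) :
    Continuous fun A : Matrix (ι × ι) (ι × ι) ℂ => φ (mapOfMatrix A) :=
  LinearMap.continuous_of_finiteDimensional (φ ∘ₗ mapOfMatrix.toLinearMap)

end Semigroup

/-! ### Hellinger-type lower bound for the relative entropy. -/

section RelativeEntropy

open scoped ComplexOrder

variable {κ : Type*} [Fintype κ] [DecidableEq κ]

/-- The scalar inequality behind the Hellinger lower bound for the relative entropy. -/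
theorem sq_sqrt_sub_sqrt_le {a b : ℝ} (ha : 0 ≤ a) (hb : 0 ≤ b) (hab : b = 0 → a = 0) :
    (√a - √b) ^ 2 ≤ a * Real.log a - a * Real.log b - a + b := by
  rcases ha.eq_or_lt with rfl | ha'
  · simp [Real.sq_sqrt hb]
  have hb' : 0 < b := lt_of_le_of_ne hb fun h => ha'.ne' (hab h.symm)
  have sa := Real.sqrt_pos.2 ha'
  have sb := Real.sqrt_pos.2 hb'
  -- log x ≤ x − 1 at x = √(b/a), to be multiplied by a.
  have h := Real.log_le_sub_one_of_pos (div_pos sb sa)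
  rw [Real.log_div sb.ne' sa.ne', Real.log_sqrt hb, Real.log_sqrt ha] at h
  have h2 : a * (√b / √a) = √a * √b := by
    nth_rewrite 1 [← Real.mul_self_sqrt ha]
    field_simp
  have h3 := mul_le_mul_of_nonneg_left h ha
  rw [mul_sub, mul_sub, mul_one, h2] at h3
  nlinarith [Real.sq_sqrt ha, Real.sq_sqrt hb]

/-- The matrix of overlaps of the eigenbases of two Hermitian matrices. -/
def eigenOverlap {A B : Matrix κ κ ℂ} (hA : A.IsHermitian) (hB : B.IsHermitian) :
    Matrix κ κ ℂ :=
  (hA.eigenvectorUnitary : Matrix κ κ ℂ)ᴴ * (hB.eigenvectorUnitary : Matrix κ κ ℂ)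

/-- Expanding in the two eigenbases replaces a noncommuting pair by pairs of eigenvalues with
nonnegative weights, so trace inequalities follow from scalar ones. -/
theorem trace_cfc_mul_cfc {A B : Matrix κ κ ℂ} (hA : A.IsHermitian) (hB : B.IsHermitian)
    (f g : ℝ → ℝ) :
    (trace (cfc f A * cfc g B)).re = ∑ i, ∑ j,
      f (hA.eigenvalues i) * g (hB.eigenvalues j) * ‖eigenOverlap hA hB i j‖ ^ 2 := by
  have e : trace (cfc f A * cfc g B) =
      trace (diagonal (fun i => (f (hA.eigenvalues i) : ℂ)) * eigenOverlap hA hB *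
        diagonal (fun j => (g (hB.eigenvalues j) : ℂ)) * (eigenOverlap hA hB)ᴴ) := by
    rw [hA.cfc_eq, hB.cfc_eq, IsHermitian.cfc, IsHermitian.cfc, Unitary.conjStarAlgAut_apply,
      Unitary.conjStarAlgAut_apply]
    simp only [eigenOverlap, conjTranspose_mul, conjTranspose_conjTranspose,
      star_eq_conjTranspose]
    simp only [Matrix.mul_assoc]
    rw [trace_mul_comm]
    simp only [Matrix.mul_assoc]
    rfl
  rw [e, trace, Complex.re_sum]
  refine Finset.sum_congr rfl fun i _ => ?_
  rw [diag_apply, Matrix.mul_apply, Complex.re_sum]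
  refine Finset.sum_congr rfl fun j _ => ?_
  rw [mul_diagonal, diagonal_mul, conjTranspose_apply, ← Complex.normSq_eq_norm_sq,
    ← Complex.ofReal_re (_ * _ * Complex.normSq _)]
  congr 1
  push_cast
  rw [← Complex.mul_conj]
  simp only [Complex.star_def]
  ring

/-- A null eigenvector of `B` lies in ker A, hence is orthogonal to every eigenvector of `A` with
nonzero eigenvalue. This removes exactly the pairs for which the scalar inequality is unavailable.
-/
theorem eigenOverlap_eq_zero {A B : Matrix κ κ ℂ} (hA : A.IsHermitian) (hB : B.IsHermitian)
    (hker : ∀ v : κ → ℂ, B *ᵥ v = 0 → A *ᵥ v = 0) {i j : κ} (hj : hB.eigenvalues j = 0)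
    (hi : hA.eigenvalues i ≠ 0) : eigenOverlap hA hB i j = 0 := by
  have hv : A *ᵥ (hB.eigenvectorBasis j).ofLp = 0 := by
    refine hker _ ?_
    rw [hB.mulVec_eigenvectorBasis, hj, zero_smul]
  have h1 : (A * (hB.eigenvectorUnitary : Matrix κ κ ℂ)).col j = 0 := by
    rw [← hv]
    ext k
    simp [Matrix.mul_apply, mulVec, dotProduct, IsHermitian.eigenvectorUnitary_apply]
  have h2 : (hA.eigenvectorUnitary : Matrix κ κ ℂ)ᴴ * (A * (hB.eigenvectorUnitary : Matrix κ κ ℂ))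
      = diagonal (fun i => (hA.eigenvalues i : ℂ)) * eigenOverlap hA hB := by
    have h := hA.spectral_theorem
    rw [Unitary.conjStarAlgAut_apply, star_eq_conjTranspose] at h
    have hu : (hA.eigenvectorUnitary : Matrix κ κ ℂ)ᴴ * (hA.eigenvectorUnitary : Matrix κ κ ℂ)
        = 1 := by
      rw [← star_eq_conjTranspose]; exact Unitary.coe_star_mul_self _
    have h' : (hA.eigenvectorUnitary : Matrix κ κ ℂ)ᴴ * A =
        diagonal (fun i => (hA.eigenvalues i : ℂ)) *
          (hA.eigenvectorUnitary : Matrix κ κ ℂ)ᴴ := by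
      refine (congrArg _ h).trans ?_
      rw [← Matrix.mul_assoc, ← Matrix.mul_assoc, hu, Matrix.one_mul]
      rfl
    rw [← Matrix.mul_assoc, h', Matrix.mul_assoc, eigenOverlap]
  have h3 := congrFun (congrFun h2 i) j
  rw [diagonal_mul, Matrix.mul_apply] at h3
  have h4 : ∀ k, (A * (hB.eigenvectorUnitary : Matrix κ κ ℂ)) k j = 0 := fun k => congrFun h1 k
  simp only [h4, mul_zero, Finset.sum_const_zero] at h3
  simpa [hi] using h3.symm

theorem cfc_sqrt_mul_self {A : Matrix κ κ ℂ} (hA : A.PosSemidef) :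
    cfc Real.sqrt A * cfc Real.sqrt A = A := by
  have hA' : IsSelfAdjoint A := hA.isHermitian
  have hc : ∀ f : ℝ → ℝ, ContinuousOn f (spectrum ℝ A) := fun f =>
    (Matrix.finite_real_spectrum (A := A)).continuousOn f
  rw [← cfc_mul _ _ _ (hc _) (hc _)]
  nth_rewrite 2 [← cfc_id ℝ A hA']
  refine cfc_congr fun x hx => ?_
  rw [hA.isHermitian.spectrum_real_eq_range_eigenvalues] at hx
  obtain ⟨i, rfl⟩ := hx
  exact Real.mul_self_sqrt (hA.eigenvalues_nonneg i)

/-- The relative entropy dominates the squared Hilbert–Schmidt distance of the square roots. -/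
theorem trace_sq_sqrt_sub_sqrt_le {A B : Matrix κ κ ℂ} (hA : A.PosSemidef) (hB : B.PosSemidef)
    (htr : trace A = trace B) (hker : ∀ v : κ → ℂ, B *ᵥ v = 0 → A *ᵥ v = 0) :
    (trace ((cfc Real.sqrt A - cfc Real.sqrt B) * (cfc Real.sqrt A - cfc Real.sqrt B))).re ≤
      (trace (A * (cfc Real.log A - cfc Real.log B))).re := by
  have hA' := hA.isHermitian
  have hB' := hB.isHermitian
  have hAs : IsSelfAdjoint A := hA'
  have hBs : IsSelfAdjoint B := hB'
  have hc : ∀ f : ℝ → ℝ, ContinuousOn f (spectrum ℝ A) := fun f =>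
    (Matrix.finite_real_spectrum (A := A)).continuousOn f
  have hone : cfc (fun _ : ℝ => (1 : ℝ)) A = 1 := cfc_const_one ℝ A
  have hone' : cfc (fun _ : ℝ => (1 : ℝ)) B = 1 := cfc_const_one ℝ B
  have eA : A = cfc (fun x : ℝ => x) A := (cfc_id' ℝ A).symm
  have eB : B = cfc (fun x : ℝ => x) B := (cfc_id' ℝ B).symm
  have t1 := trace_cfc_mul_cfc hA' hB' (fun x => x) (fun _ => 1)
  have t2 := trace_cfc_mul_cfc hA' hB' (fun _ => 1) (fun x => x)
  have t3 := trace_cfc_mul_cfc hA' hB' Real.sqrt Real.sqrt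
  have t4 := trace_cfc_mul_cfc hA' hB' (fun x => x * Real.log x) (fun _ => 1)
  have t5 := trace_cfc_mul_cfc hA' hB' (fun x => x) Real.log
  rw [hone', ← eA, mul_one] at t1
  rw [hone, ← eB, one_mul] at t2
  rw [hone', mul_one, cfc_mul _ _ _ (hc _) (hc _), ← eA] at t4
  rw [← eA] at t5
  have e1 : (trace ((cfc Real.sqrt A - cfc Real.sqrt B) *
      (cfc Real.sqrt A - cfc Real.sqrt B))).re =
      (trace A).re + (trace B).re - 2 * (trace (cfc Real.sqrt A * cfc Real.sqrt B)).re := by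
    rw [sub_mul, mul_sub, mul_sub, cfc_sqrt_mul_self hA, cfc_sqrt_mul_self hB, trace_sub,
      trace_sub, trace_sub, trace_mul_comm (cfc Real.sqrt B)]
    simp only [Complex.sub_re]
    ring
  -- Equality of traces allows the terms −a + b of the scalar inequality to be inserted.
  have e2 : (trace (A * (cfc Real.log A - cfc Real.log B))).re =
      (trace (A * cfc Real.log A)).re - (trace (A * cfc Real.log B)).re -
        (trace A).re + (trace B).re := by
    rw [mul_sub, trace_sub, Complex.sub_re, htr]
    ring
  rw [e1, e2, t1, t2, t3, t4, t5]
  simp only [Finset.mul_sum, ← Finset.sum_add_distrib, ← Finset.sum_sub_distrib]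
  refine Finset.sum_le_sum fun i _ => Finset.sum_le_sum fun j _ => ?_
  by_cases h : hB'.eigenvalues j = 0 → hA'.eigenvalues i = 0
  · have ha := hA.eigenvalues_nonneg i
    have hb := hB.eigenvalues_nonneg j
    have key := mul_le_mul_of_nonneg_right (sq_sqrt_sub_sqrt_le ha hb h)
      (sq_nonneg ‖eigenOverlap hA' hB' i j‖)
    rw [sub_sq, Real.sq_sqrt ha, Real.sq_sqrt hb] at key
    linarith
  · push Not at h
    simp [eigenOverlap_eq_zero hA' hB' hker h.1 h.2]

/-- The Frobenius norm dominates the operator norm: Cauchy–Schwarz in each row. -/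
theorem norm_mulVec_sq_le {κ : Type*} [Fintype κ] {C : Matrix κ κ ℂ} (hC : C.IsHermitian) (w : κ → ℂ) :
    ‖WithLp.toLp 2 (C *ᵥ w)‖ ^ 2 ≤ (trace (C * C)).re * ‖WithLp.toLp 2 w‖ ^ 2 := by
  have h : (trace (C * C)).re = ∑ i, ∑ j, ‖C i j‖ ^ 2 := by
    rw [trace, Complex.re_sum]
    refine Finset.sum_congr rfl fun i _ => ?_
    rw [diag_apply, Matrix.mul_apply, Complex.re_sum]
    refine Finset.sum_congr rfl fun j _ => ?_
    rw [← hC.apply j i, Complex.star_def, Complex.mul_conj, Complex.ofReal_re,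
      Complex.normSq_eq_norm_sq]
  rw [EuclideanSpace.norm_sq_eq, EuclideanSpace.norm_sq_eq, h, Finset.sum_mul]
  refine Finset.sum_le_sum fun i _ => ?_
  calc ‖(C *ᵥ w) i‖ ^ 2 ≤ (∑ j, ‖C i j‖ * ‖w j‖) ^ 2 := by
        gcongr
        refine (norm_sum_le _ _).trans (Finset.sum_le_sum fun j _ => ?_)
        exact norm_mul_le _ _
    _ ≤ _ := Finset.sum_mul_sq_le_sq_mul_sq _ _ _

/-- Expressing the root of an expectation as a norm makes the reverse triangle inequality
applicable. -/
theorem norm_cfc_sqrt_mulVec {A : Matrix κ κ ℂ} (hA : A.PosSemidef) (w : κ → ℂ) :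
    ‖WithLp.toLp 2 (cfc Real.sqrt A *ᵥ w)‖ = √(star w ⬝ᵥ A *ᵥ w).re := by
  have hs : (cfc Real.sqrt A)ᴴ = cfc Real.sqrt A := cfc_predicate Real.sqrt A
  have h : (star w ⬝ᵥ A *ᵥ w) = star (cfc Real.sqrt A *ᵥ w) ⬝ᵥ (cfc Real.sqrt A *ᵥ w) := by
    rw [star_mulVec, hs, ← dotProduct_mulVec, mulVec_mulVec, cfc_sqrt_mul_self hA]
  rw [h, EuclideanSpace.norm_eq]
  congr 1
  rw [dotProduct, Complex.re_sum]
  refine Finset.sum_congr rfl fun i _ => ?_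
  rw [Pi.star_apply, Complex.star_def, mul_comm, Complex.mul_conj, Complex.ofReal_re,
    Complex.normSq_eq_norm_sq]

/-- A lower bound for the relative entropy by the expectations in a single vector. -/
theorem sq_sqrt_expectation_sub_le {A B : Matrix κ κ ℂ} (hA : A.PosSemidef) (hB : B.PosSemidef)
    (htr : trace A = trace B) {δ : ℝ} (hS : relativeEntropy A B ≤ (δ : EReal)) (w : κ → ℂ) :
    (√(star w ⬝ᵥ A *ᵥ w).re - √(star w ⬝ᵥ B *ᵥ w).re) ^ 2 ≤ δ * ‖WithLp.toLp 2 w‖ ^ 2 := by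
  unfold relativeEntropy at hS
  split_ifs at hS with hker
  · have h1 := (trace_sq_sqrt_sub_sqrt_le hA hB htr hker).trans (EReal.coe_le_coe_iff.1 hS)
    have hC : (cfc Real.sqrt A - cfc Real.sqrt B).IsHermitian :=
      IsHermitian.sub (cfc_predicate Real.sqrt A) (cfc_predicate Real.sqrt B)
    have h2 := norm_mulVec_sq_le hC w
    have h3 : |√(star w ⬝ᵥ A *ᵥ w).re - √(star w ⬝ᵥ B *ᵥ w).re| ≤
        ‖WithLp.toLp 2 ((cfc Real.sqrt A - cfc Real.sqrt B) *ᵥ w)‖ := by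
      rw [← norm_cfc_sqrt_mulVec hA, ← norm_cfc_sqrt_mulVec hB, sub_mulVec, WithLp.toLp_sub]
      exact abs_norm_sub_norm_le _ _
    rw [← sq_abs]
    refine (pow_le_pow_left₀ (abs_nonneg _) h3 2).trans (h2.trans ?_)
    gcongr
  · exact absurd hS (by simp)

theorem relativeEntropy_self (A : Matrix κ κ ℂ) : relativeEntropy A A = 0 := by
  rw [relativeEntropy, if_pos fun _ h => h]
  simp

end RelativeEntropy

/-! ### Complete positivity of the semigroup. -/

section CompletePositivity

open scoped ComplexOrder

/-- The blockwise action of a map on matrices, `id ⊗ T`. -/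
def amplification (T : Matrix ι ι ℂ →ₗ[ℂ] Matrix ι ι ℂ) (M : Matrix (ι × ι) (ι × ι) ℂ) :
    Matrix (ι × ι) (ι × ι) ℂ :=
  Matrix.of fun a b => T (Matrix.of fun i j => M (a.1, i) (b.1, j)) a.2 b.2

/-- Complete positivity of a map on matrices. -/
def IsCompletelyPositive (T : Matrix ι ι ℂ →ₗ[ℂ] Matrix ι ι ℂ) : Prop :=
  ∀ M : Matrix (ι × ι) (ι × ι) ℂ, M.PosSemidef → (amplification T M).PosSemidef

/-- The map `x ↦ K* x K`. -/
def krausMap (K : Matrix ι ι ℂ) : Matrix ι ι ℂ →ₗ[ℂ] Matrix ι ι ℂ :=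
  LinearMap.mulLeft ℂ Kᴴ ∘ₗ LinearMap.mulRight ℂ K

theorem krausMap_apply (K x : Matrix ι ι ℂ) : krausMap K x = Kᴴ * x * K := by
  simp [krausMap, Matrix.mul_assoc]

theorem IsCompletelyPositive.one :
    IsCompletelyPositive (1 : Matrix ι ι ℂ →ₗ[ℂ] Matrix ι ι ℂ) := fun _ hM => hM

theorem IsCompletelyPositive.mul {S T : Matrix ι ι ℂ →ₗ[ℂ] Matrix ι ι ℂ}
    (hS : IsCompletelyPositive S) (hT : IsCompletelyPositive T) :
    IsCompletelyPositive (S * T) := fun M hM => hS _ (hT M hM)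

theorem IsCompletelyPositive.pow {T : Matrix ι ι ℂ →ₗ[ℂ] Matrix ι ι ℂ}
    (hT : IsCompletelyPositive T) (n : ℕ) : IsCompletelyPositive (T ^ n) := by
  induction n with
  | zero => exact .one
  | succ n ih => rw [pow_succ]; exact ih.mul hT

theorem IsCompletelyPositive.zero :
    IsCompletelyPositive (0 : Matrix ι ι ℂ →ₗ[ℂ] Matrix ι ι ℂ) := fun _ _ => PosSemidef.zero

theorem IsCompletelyPositive.add {S T : Matrix ι ι ℂ →ₗ[ℂ] Matrix ι ι ℂ}
    (hS : IsCompletelyPositive S) (hT : IsCompletelyPositive T) :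
    IsCompletelyPositive (S + T) := fun M hM => (hS M hM).add (hT M hM)

theorem IsCompletelyPositive.smul {T : Matrix ι ι ℂ →ₗ[ℂ] Matrix ι ι ℂ}
    (hT : IsCompletelyPositive T) {c : ℝ} (hc : 0 ≤ c) :
    IsCompletelyPositive ((c : ℂ) • T) := fun M hM =>
  (hT M hM).smul (α := ℂ) (Complex.zero_le_real.2 hc)

/-- The amplified map is conjugation by 1 ⊗ K, which preserves positivity. -/
theorem isCompletelyPositive_krausMap (K : Matrix ι ι ℂ) :
    IsCompletelyPositive (krausMap K) := by
  intro M hM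
  have h : amplification (krausMap K) M =
      ((1 : Matrix ι ι ℂ) ⊗ₖ K)ᴴ * M * ((1 : Matrix ι ι ℂ) ⊗ₖ K) := by
    ext ⟨k, i⟩ ⟨l, j⟩
    simp only [amplification, of_apply, krausMap_apply, Matrix.mul_apply, conjTranspose_apply,
      kroneckerMap_apply, Fintype.sum_prod_type, one_apply, apply_ite star, star_zero,
      ite_mul, mul_ite, one_mul, zero_mul, mul_zero]
    simp
  rw [h]
  exact hM.conjTranspose_mul_mul_same _

theorem isClosed_setOf_posSemidef {κ : Type*} [Fintype κ] :
    IsClosed {M : Matrix κ κ ℂ | M.PosSemidef} := by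
  have h : {M : Matrix κ κ ℂ | M.PosSemidef} =
      {M | Mᴴ = M} ∩ ⋂ v : κ → ℂ, {M | 0 ≤ star v ⬝ᵥ M *ᵥ v} := by
    ext M
    simp [posSemidef_iff_dotProduct_mulVec, IsHermitian]
  rw [h]
  refine (isClosed_eq (by fun_prop) (by fun_prop)).inter (isClosed_iInter fun v => ?_)
  exact isClosed_le continuous_const (by fun_prop)

/-- The functional `T ↦ (T X) i j`. -/
def applyEntry (X : Matrix ι ι ℂ) (i j : ι) : (Matrix ι ι ℂ →ₗ[ℂ] Matrix ι ι ℂ) →ₗ[ℂ] ℂ :=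
  Matrix.entryLinearMap ℂ ℂ i j ∘ₗ LinearMap.applyₗ X

theorem applyEntry_apply (X : Matrix ι ι ℂ) (i j : ι) (T : Matrix ι ι ℂ →ₗ[ℂ] Matrix ι ι ℂ) :
    applyEntry X i j T = T X i j := rfl

theorem isClosed_isCompletelyPositive :
    IsClosed {A : Matrix (ι × ι) (ι × ι) ℂ | IsCompletelyPositive (mapOfMatrix A)} := by
  have h : {A : Matrix (ι × ι) (ι × ι) ℂ | IsCompletelyPositive (mapOfMatrix A)} =
      ⋂ M : Matrix (ι × ι) (ι × ι) ℂ, ⋂ _ : M.PosSemidef,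
        {A | (amplification (mapOfMatrix A) M).PosSemidef} := by
    ext A
    simp [IsCompletelyPositive]
  rw [h]
  refine isClosed_iInter fun M => isClosed_iInter fun _ => ?_
  refine isClosed_setOf_posSemidef.preimage (continuous_matrix fun a b => ?_)
  exact continuous_mapOfMatrix_apply (applyEntry _ a.2 b.2)

/-- Generators of the form `x ↦ G* x + x G + Φ(x)` with `Φ` completely positive. -/
def IsLindbladian (L : Matrix ι ι ℂ →ₗ[ℂ] Matrix ι ι ℂ) : Prop :=
  ∃ (G : Matrix ι ι ℂ) (Φ : Matrix ι ι ℂ →ₗ[ℂ] Matrix ι ι ℂ), IsCompletelyPositive Φ ∧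
    ∀ x, L x = Gᴴ * x + x * G + Φ x

theorem IsLindbladian.add {L M : Matrix ι ι ℂ →ₗ[ℂ] Matrix ι ι ℂ}
    (hL : IsLindbladian L) (hM : IsLindbladian M) : IsLindbladian (L + M) := by
  obtain ⟨G, Φ, hΦ, h⟩ := hL
  obtain ⟨G', Φ', hΦ', h'⟩ := hM
  refine ⟨G + G', Φ + Φ', hΦ.add hΦ', fun x => ?_⟩
  rw [LinearMap.add_apply, LinearMap.add_apply, h, h', conjTranspose_add]
  noncomm_ring

theorem IsLindbladian.sum {β : Type*} (s : Finset β) {L : β → Matrix ι ι ℂ →ₗ[ℂ] Matrix ι ι ℂ}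
    (hL : ∀ b ∈ s, IsLindbladian (L b)) : IsLindbladian (∑ b ∈ s, L b) := by
  refine Finset.sum_induction L IsLindbladian (fun _ _ => IsLindbladian.add) ?_ hL
  exact ⟨0, 0, .zero, fun x => by simp⟩

/-- Commutator and anticommutators are absorbed in `G`; the two jump terms form the completely
positive part. -/
theorem isLindbladian_localGenerator {H W : Matrix ι ι ℂ} (hH : H.IsHermitian) {γm γp : ℝ}
    (hm : 0 ≤ γm) (hp : 0 ≤ γp) : IsLindbladian (localGenerator H W γm γp) := by
  refine ⟨-(Complex.I • H) - ((γm : ℂ) / 2) • (Wᴴ * W) - ((γp : ℂ) / 2) • (W * Wᴴ),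
    (γm : ℂ) • krausMap W + (γp : ℂ) • krausMap Wᴴ,
    ((isCompletelyPositive_krausMap W).smul hm).add
      ((isCompletelyPositive_krausMap Wᴴ).smul hp), fun x => ?_⟩
  simp only [localGenerator, LinearMap.coe_mk, AddHom.coe_mk, LinearMap.add_apply,
    LinearMap.smul_apply, krausMap_apply, conjTranspose_sub, conjTranspose_neg,
    conjTranspose_smul, conjTranspose_mul, conjTranspose_conjTranspose, hH.eq,
    Complex.star_def, Complex.conj_I, map_div₀, Complex.conj_ofReal, map_ofNat]
  simp only [Matrix.sub_mul, Matrix.mul_sub, Matrix.neg_mul, Matrix.mul_neg, Matrix.smul_mul,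
    Matrix.mul_smul, smul_add, smul_sub, smul_smul]
  module

theorem isLindbladian_generator {ε : ι → ℝ} {V : Matrix ι ι ℂ} {H : ℝ → Matrix ι ι ℂ}
    {γm γp : ℝ → ℝ} (hγm : ∀ ω ∈ bohrFrequencies ε, 0 < γm ω)
    (hγp : ∀ ω ∈ bohrFrequencies ε, 0 < γp ω) (hH : ∀ ω ∈ bohrFrequencies ε, (H ω).IsHermitian) :
    IsLindbladian (generator ε V H γm γp) :=
  .sum _ fun ω hω => isLindbladian_localGenerator (hH ω hω) (hγm ω hω).le (hγp ω hω).le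

theorem IsLindbladian.isCompletelyPositive_semigroup [Nonempty ι]
    {L : Matrix ι ι ℂ →ₗ[ℂ] Matrix ι ι ℂ} (hL : IsLindbladian L) {t : ℝ} (ht : 0 ≤ t) :
    IsCompletelyPositive (semigroup L t) := by
  obtain ⟨G, Φ, hΦ, h⟩ := hL
  refine semigroup_induction L (krausMap G) _ isClosed_isCompletelyPositive
    (fun s hs n => .pow ?_ n) t ht
  -- The second-order term s² G*xG completes the square (1 + sG)* x (1 + sG), making the approximant
  -- completely positive without affecting the limit.
  have e : 1 + (s : ℂ) • L + ((s ^ 2 : ℝ) : ℂ) • krausMap G =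
      krausMap (1 + (s : ℂ) • G) + (s : ℂ) • Φ := by
    refine LinearMap.ext fun x => ?_
    simp only [LinearMap.add_apply, LinearMap.smul_apply, Module.End.one_apply, h, krausMap_apply,
      conjTranspose_add, conjTranspose_one, conjTranspose_smul, Complex.star_def,
      Complex.conj_ofReal, Matrix.add_mul, Matrix.mul_add, Matrix.one_mul, Matrix.mul_one,
      Matrix.smul_mul, Matrix.mul_smul]
    push_cast
    module
  rw [e]
  exact (isCompletelyPositive_krausMap _).add (hΦ.smul hs)

end CompletePositivity

/-! ### Densities of the two-point states. -/

section TwoPointDensity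

open scoped ComplexOrder

variable (T : ℝ → Matrix ι ι ℂ →ₗ[ℂ] Matrix ι ι ℂ) (p : ι → ℝ) (t : ℝ)

theorem trace_sqrtDensity_mul (p : ι → ℝ) (X Y : Matrix ι ι ℂ) :
    trace (sqrtDensity p * X * sqrtDensity p * Y) =
      ∑ i, ∑ j, √(p i) * X i j * √(p j) * Y j i := by
  rw [trace]
  refine Finset.sum_congr rfl fun i _ => ?_
  rw [diag_apply, Matrix.mul_apply]
  refine Finset.sum_congr rfl fun j _ => ?_
  rw [sqrtDensity, mul_diagonal, diagonal_mul]

theorem twoPointDensity_forwardState_apply (a b : ι × ι) :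
    twoPointDensity (forwardState T p t) a b =
      √(p a.1) * √(p b.1) * T t (Matrix.single b.2 a.2 1) b.1 a.1 := by
  rw [twoPointDensity, of_apply, forwardState, LinearMap.mk₂_apply, transpose_single,
    trace_sqrtDensity_mul, Finset.sum_eq_single a.1, Finset.sum_eq_single b.1]
  · simp
  · intro j _ hj
    simp [hj.symm]
  · simp
  · intro i _ hi
    refine Finset.sum_eq_zero fun j _ => ?_
    simp [hi.symm]
  · simp

theorem twoPointDensity_backwardState_apply (a b : ι × ι) :
    twoPointDensity (backwardState T p t) a b =
      √(p a.2) * √(p b.2) * T t (Matrix.single b.1 a.1 1) b.2 a.2 := by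
  rw [twoPointDensity, of_apply, backwardState, LinearMap.mk₂_apply,
    trace_sqrtDensity_mul, Finset.sum_eq_single a.2, Finset.sum_eq_single b.2]
  · simp only [transpose_apply, Matrix.single_apply, and_self, if_true]
    ring
  · intro j _ hj
    simp [hj.symm]
  · simp
  · intro i _ hi
    refine Finset.sum_eq_zero fun j _ => ?_
    simp [hi.symm]
  · simp

/-- Time reversal is the exchange of tensor factors, so positivity, trace and expectations transfer
from the forward density. -/
theorem twoPointDensity_backwardState :
    twoPointDensity (backwardState T p t) =
      (twoPointDensity (forwardState T p t)).submatrix Prod.swap Prod.swap := by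
  ext a b
  rw [submatrix_apply, twoPointDensity_backwardState_apply, twoPointDensity_forwardState_apply]
  simp

theorem trace_twoPointDensity_forwardState_eq :
    trace (twoPointDensity (forwardState T p t)) =
      trace (twoPointDensity (backwardState T p t)) := by
  rw [twoPointDensity_backwardState]
  exact (Equiv.sum_comp (Equiv.prodComm ι ι)
    fun a => twoPointDensity (forwardState T p t) a a).symm

variable {T p t}

/-- The density is the Choi matrix of `T t`, transposed, with factors exchanged, and conjugated by
ρ^{1/2} ⊗ 1. -/
theorem IsCompletelyPositive.posSemidef_forwardState (hT : IsCompletelyPositive (T t)) :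
    (twoPointDensity (forwardState T p t)).PosSemidef := by
  have h1 := hT _ (posSemidef_vecMulVec_self_star
    (fun a : ι × ι => if a.1 = a.2 then (1 : ℂ) else 0))
  have h2 := (h1.transpose.submatrix Prod.swap).mul_mul_conjTranspose_same
    (diagonal fun a : ι × ι => (√(p a.1) : ℂ))
  suffices h : twoPointDensity (forwardState T p t) = _ by rw [h]; exact h2
  ext a b
  rw [twoPointDensity_forwardState_apply, diagonal_conjTranspose, mul_diagonal, diagonal_mul,
    submatrix_apply, transpose_apply]
  have e : (of fun i j => vecMulVec (fun a : ι × ι => if a.1 = a.2 then (1 : ℂ) else 0)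
      (star fun a : ι × ι => if a.1 = a.2 then (1 : ℂ) else 0) (b.2, i) (a.2, j)) =
      Matrix.single b.2 a.2 1 := by
    ext i j
    simp only [of_apply, vecMulVec_apply, Pi.star_apply, apply_ite star, star_one, star_zero,
      Matrix.single_apply]
    by_cases h1 : b.2 = i <;> by_cases h2 : a.2 = j <;> simp [h1, h2]
  simp only [amplification, of_apply, Prod.fst_swap, Prod.snd_swap, e, Pi.star_apply,
    Complex.star_def, Complex.conj_ofReal]
  ring

theorem IsCompletelyPositive.posSemidef_backwardState (hT : IsCompletelyPositive (T t)) :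
    (twoPointDensity (backwardState T p t)).PosSemidef := by
  rw [twoPointDensity_backwardState]
  exact hT.posSemidef_forwardState.submatrix _

end TwoPointDensity

/-! ### Grading of matrices by energy loss. -/

section BohrDegree

/-- The matrix lowers the energy by exactly `ω`. -/
def HasBohrDegree (ε : ι → ℝ) (A : Matrix ι ι ℂ) (ω : ℝ) : Prop :=
  ∀ i j, A i j ≠ 0 → ε j - ε i = ω

variable {ε : ι → ℝ} {A B : Matrix ι ι ℂ} {ω ω' : ℝ}

theorem HasBohrDegree.mul (hA : HasBohrDegree ε A ω) (hB : HasBohrDegree ε B ω') :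
    HasBohrDegree ε (A * B) (ω + ω') := by
  intro i j h
  rw [Matrix.mul_apply] at h
  obtain ⟨k, _, hk⟩ := Finset.exists_ne_zero_of_sum_ne_zero h
  have h1 := hA i k (left_ne_zero_of_mul hk)
  have h2 := hB k j (right_ne_zero_of_mul hk)
  linarith

theorem HasBohrDegree.conjTranspose (hA : HasBohrDegree ε A ω) : HasBohrDegree ε Aᴴ (-ω) := by
  intro i j h
  have := hA j i (by simpa using h)
  linarith

theorem hasBohrDegree_sqrtDensity (ε p : ι → ℝ) : HasBohrDegree ε (sqrtDensity p) 0 := by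
  intro i j h
  by_cases hij : i = j
  · simp [hij]
  · exact absurd (diagonal_apply_ne _ hij) h

/-- Diagonal entries have degree 0. This is what isolates a single Bohr frequency in the generator.
-/
theorem HasBohrDegree.trace_eq_zero (hA : HasBohrDegree ε A ω) (hω : ω ≠ 0) : trace A = 0 := by
  refine Finset.sum_eq_zero fun i _ => ?_
  by_contra h
  exact hω (by simpa using (hA i i h).symm)

theorem bohrComponent_apply (ε : ι → ℝ) (V : Matrix ι ι ℂ) (ω : ℝ) (i j : ι) :
    bohrComponent ε V ω i j = if ε j - ε i = ω then V i j else 0 := by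
  rw [bohrComponent, Matrix.sum_apply]
  simp only [spectralProjection, mul_diagonal, diagonal_mul]
  have h : ∀ q : ℝ × ℝ, (if ε i = q.2 then (1 : ℂ) else 0) * V i j *
      (if ε j = q.1 then (1 : ℂ) else 0) = if q = (ε j, ε i) then V i j else 0 := by
    rintro ⟨a, b⟩
    by_cases h1 : ε i = b <;> by_cases h2 : ε j = a <;>
      simp [h1, h2, eq_comm (a := a), eq_comm (a := b)]
  simp only [h, Finset.sum_ite_eq', Finset.mem_filter, Finset.mem_product]
  simp [energies]

theorem hasBohrDegree_bohrComponent (ε : ι → ℝ) (V : Matrix ι ι ℂ) (ω : ℝ) :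
    HasBohrDegree ε (bohrComponent ε V ω) ω := by
  intro i j h
  rw [bohrComponent_apply] at h
  by_contra hne
  exact h (if_neg hne)

end BohrDegree

/-! ### Expectations of the two-point densities, and their slopes at time zero. -/

section Expectation

/-- The map `x ↦ P x Q`. -/
def sandwich (P Q : Matrix ι ι ℂ) : Matrix ι ι ℂ →ₗ[ℂ] Matrix ι ι ℂ :=
  LinearMap.mulLeft ℂ P ∘ₗ LinearMap.mulRight ℂ Q

theorem sandwich_apply (P Q x : Matrix ι ι ℂ) : sandwich P Q x = P * x * Q := by
  simp [sandwich, Matrix.mul_assoc]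

/-- The expectation, as a function of `T`, of the density `twoPointDensity (forwardState T p t)`
in the vector with coordinates `W a.2 a.1`. -/
def choiExpectation (p : ι → ℝ) (W : Matrix ι ι ℂ) :
    (Matrix ι ι ℂ →ₗ[ℂ] Matrix ι ι ℂ) →ₗ[ℂ] ℂ :=
  ∑ a, ∑ b, ((√(p a) * √(p b) : ℝ) : ℂ) •
    applyEntry (vecMulVec (fun i => W i b) (star fun i => W i a)) b a

theorem choiExpectation_apply (p : ι → ℝ) (W : Matrix ι ι ℂ)
    (T : Matrix ι ι ℂ →ₗ[ℂ] Matrix ι ι ℂ) :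
    choiExpectation p W T = ∑ a, ∑ b, ((√(p a) * √(p b) : ℝ) : ℂ) *
      T (vecMulVec (fun i => W i b) (star fun i => W i a)) b a := by
  simp [choiExpectation, LinearMap.sum_apply, applyEntry_apply]

theorem expectation_forwardState (T : ℝ → Matrix ι ι ℂ →ₗ[ℂ] Matrix ι ι ℂ) (p : ι → ℝ) (t : ℝ)
    (W : Matrix ι ι ℂ) :
    (star fun a : ι × ι => W a.2 a.1) ⬝ᵥ
      twoPointDensity (forwardState T p t) *ᵥ (fun a : ι × ι => W a.2 a.1) =
      choiExpectation p W (T t) := by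
  rw [choiExpectation_apply]
  simp only [dotProduct, mulVec, twoPointDensity_forwardState_apply, Fintype.sum_prod_type,
    Pi.star_apply, Finset.mul_sum]
  refine Finset.sum_congr rfl fun a _ => ?_
  rw [Finset.sum_comm]
  refine Finset.sum_congr rfl fun b _ => ?_
  rw [matrix_eq_sum_single (vecMulVec _ _)]
  simp only [map_sum, Matrix.sum_apply]
  rw [Finset.mul_sum, Finset.sum_comm]
  refine Finset.sum_congr rfl fun k _ => ?_
  rw [Finset.mul_sum]
  refine Finset.sum_congr rfl fun l _ => ?_
  have h : Matrix.single k l (vecMulVec (fun i => W i b) (star fun i => W i a) k l) =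
      (W k b * star (W l a)) • Matrix.single k l (1 : ℂ) := by
    simp [vecMulVec_apply]
  rw [h, map_smul, Matrix.smul_apply, smul_eq_mul]
  push_cast
  ring

theorem expectation_backwardState (T : ℝ → Matrix ι ι ℂ →ₗ[ℂ] Matrix ι ι ℂ) (p : ι → ℝ) (t : ℝ)
    (W : Matrix ι ι ℂ) :
    (star fun a : ι × ι => W a.2 a.1) ⬝ᵥ
      twoPointDensity (backwardState T p t) *ᵥ (fun a : ι × ι => W a.2 a.1) =
      choiExpectation p Wᵀ (T t) := by
  rw [← expectation_forwardState, twoPointDensity_backwardState]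
  generalize twoPointDensity (forwardState T p t) = D
  simp only [dotProduct, mulVec, submatrix_apply, transpose_apply, Pi.star_apply,
    Fintype.sum_prod_type, Prod.swap_prod_mk]
  rw [Finset.sum_comm]
  refine Finset.sum_congr rfl fun a _ => Finset.sum_congr rfl fun b _ => ?_
  rw [Finset.sum_comm]

theorem trace_sqrtDensity_mul_eq_sum (p : ι → ℝ) (X : Matrix ι ι ℂ) :
    trace (sqrtDensity p * X) = ∑ i, √(p i) * X i i := by
  simp [trace, sqrtDensity, diagonal_mul]

/-- The Choi matrix of x ↦ PxQ has rank one, so its expectation factors. -/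
theorem choiExpectation_sandwich (p : ι → ℝ) (W P Q : Matrix ι ι ℂ) :
    choiExpectation p W (sandwich P Q) =
      trace (sqrtDensity p * (P * W)) * trace (sqrtDensity p * (Wᴴ * Q)) := by
  rw [choiExpectation_apply, trace_sqrtDensity_mul_eq_sum, trace_sqrtDensity_mul_eq_sum, mul_comm,
    Finset.sum_mul_sum]
  refine Finset.sum_congr rfl fun a _ => Finset.sum_congr rfl fun b _ => ?_
  rw [sandwich_apply, mul_vecMulVec, vecMulVec_mul, vecMulVec_apply]
  have h1 : (P *ᵥ fun i => W i b) b = (P * W) b b := rfl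
  have h2 : ((star fun i => W i a) ᵥ* Q) a = (Wᴴ * Q) a a := rfl
  rw [h1, h2]
  push_cast
  ring

theorem trace_sqrtDensity_mul_conjTranspose (p : ι → ℝ) (X : Matrix ι ι ℂ) :
    trace (sqrtDensity p * Xᴴ) = star (trace (sqrtDensity p * X)) := by
  simp [trace_sqrtDensity_mul_eq_sum]

/-- The initial density projects onto the vector with coordinates √p_j on the diagonal; `hW` says
that the test vector is orthogonal to it. -/
theorem choiExpectation_one {p : ι → ℝ} {W : Matrix ι ι ℂ} (hW : trace (sqrtDensity p * W) = 0) :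
    choiExpectation p W 1 = 0 := by
  have h : (1 : Matrix ι ι ℂ →ₗ[ℂ] Matrix ι ι ℂ) = sandwich 1 1 :=
    LinearMap.ext fun x => by simp [sandwich_apply]
  rw [h, choiExpectation_sandwich, Matrix.one_mul, hW, zero_mul]

/-- Every term with the identity on one side carries the factor tr(ρ^{1/2}W) or its conjugate, hence
vanishes; each jump term yields a squared modulus. -/
theorem choiExpectation_localGenerator {p : ι → ℝ} {W : Matrix ι ι ℂ}
    (hW : trace (sqrtDensity p * W) = 0) (H V : Matrix ι ι ℂ) (γm γp : ℝ) :
    choiExpectation p W (localGenerator H V γm γp) =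
      ((γm * ‖trace (sqrtDensity p * (Vᴴ * W))‖ ^ 2 +
        γp * ‖trace (sqrtDensity p * (V * W))‖ ^ 2 : ℝ) : ℂ) := by
  have e : localGenerator H V γm γp = Complex.I • (sandwich H 1 - sandwich 1 H)
      - ((γm : ℂ) / 2) • (sandwich (Vᴴ * V) 1 - (2 : ℂ) • sandwich Vᴴ V + sandwich 1 (Vᴴ * V))
      - ((γp : ℂ) / 2) • (sandwich (V * Vᴴ) 1 - (2 : ℂ) • sandwich V Vᴴ
        + sandwich 1 (V * Vᴴ)) := by
    refine LinearMap.ext fun x => ?_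
    simp [localGenerator, sandwich_apply]
  have hW' : trace (sqrtDensity p * Wᴴ) = 0 := by
    rw [trace_sqrtDensity_mul_conjTranspose, hW, star_zero]
  have h1 : trace (sqrtDensity p * (Wᴴ * V)) = star (trace (sqrtDensity p * (Vᴴ * W))) := by
    rw [← trace_sqrtDensity_mul_conjTranspose]; simp
  have h2 : trace (sqrtDensity p * (Wᴴ * Vᴴ)) = star (trace (sqrtDensity p * (V * W))) := by
    rw [← trace_sqrtDensity_mul_conjTranspose]; simp
  have hn : ∀ z : ℂ, z * star z = ((‖z‖ ^ 2 : ℝ) : ℂ) := fun z => by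
    rw [Complex.star_def, Complex.mul_conj, Complex.normSq_eq_norm_sq]
  rw [e]
  simp only [map_sub, map_add, map_smul, choiExpectation_sandwich, Matrix.mul_one, Matrix.one_mul,
    hW, hW', h1, h2, hn, mul_zero, zero_mul, smul_eq_mul]
  push_cast
  ring

theorem choiExpectation_generator {p : ι → ℝ} {W : Matrix ι ι ℂ}
    (hW : trace (sqrtDensity p * W) = 0) (ε : ι → ℝ) (V : Matrix ι ι ℂ) (H : ℝ → Matrix ι ι ℂ)
    (γm γp : ℝ → ℝ) :
    choiExpectation p W (generator ε V H γm γp) =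
      ((∑ ω ∈ bohrFrequencies ε,
        (γm ω * ‖trace (sqrtDensity p * ((bohrComponent ε V ω)ᴴ * W))‖ ^ 2 +
        γp ω * ‖trace (sqrtDensity p * (bohrComponent ε V ω * W))‖ ^ 2) : ℝ) : ℂ) := by
  rw [generator, map_sum, Complex.ofReal_sum]
  exact Finset.sum_congr rfl fun ω _ => choiExpectation_localGenerator hW _ _ _ _

/-- Since all Bohr frequencies are positive, V_ω* W is the only product of total degree 0. -/
theorem choiExpectation_generator_of_degree_pos {p ε : ι → ℝ} {W V : Matrix ι ι ℂ} {ω : ℝ}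
    (hω : ω ∈ bohrFrequencies ε) (hW : HasBohrDegree ε W ω) (H : ℝ → Matrix ι ι ℂ)
    (γm γp : ℝ → ℝ) :
    choiExpectation p W (generator ε V H γm γp) =
      ((γm ω * ‖trace (sqrtDensity p * ((bohrComponent ε V ω)ᴴ * W))‖ ^ 2 : ℝ) : ℂ) := by
  have hω0 : 0 < ω := (Finset.mem_filter.1 hω).2
  have hs := hasBohrDegree_sqrtDensity ε p
  rw [choiExpectation_generator ((hs.mul hW).trace_eq_zero (by linarith)),
    Finset.sum_eq_single ω]
  · rw [(hs.mul ((hasBohrDegree_bohrComponent ε V ω).mul hW)).trace_eq_zero (by linarith)]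
    simp
  · intro ω' hω' hne
    have hω0' : 0 < ω' := (Finset.mem_filter.1 hω').2
    have hV := hasBohrDegree_bohrComponent ε V ω'
    rw [(hs.mul (hV.mul hW)).trace_eq_zero (by linarith),
      (hs.mul (hV.conjTranspose.mul hW)).trace_eq_zero fun h => hne (by linarith)]
    simp
  · exact fun h => absurd hω h

theorem choiExpectation_generator_of_degree_neg {p ε : ι → ℝ} {W V : Matrix ι ι ℂ} {ω : ℝ}
    (hω : ω ∈ bohrFrequencies ε) (hW : HasBohrDegree ε W (-ω)) (H : ℝ → Matrix ι ι ℂ)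
    (γm γp : ℝ → ℝ) :
    choiExpectation p W (generator ε V H γm γp) =
      ((γp ω * ‖trace (sqrtDensity p * (bohrComponent ε V ω * W))‖ ^ 2 : ℝ) : ℂ) := by
  have hω0 : 0 < ω := (Finset.mem_filter.1 hω).2
  have hs := hasBohrDegree_sqrtDensity ε p
  rw [choiExpectation_generator ((hs.mul hW).trace_eq_zero (by linarith)),
    Finset.sum_eq_single ω]
  · rw [(hs.mul ((hasBohrDegree_bohrComponent ε V ω).conjTranspose.mul hW)).trace_eq_zero
      (by linarith)]
    simp
  · intro ω' hω' hne
    have hω0' : 0 < ω' := (Finset.mem_filter.1 hω').2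
    have hV := hasBohrDegree_bohrComponent ε V ω'
    rw [(hs.mul (hV.conjTranspose.mul hW)).trace_eq_zero (by linarith),
      (hs.mul (hV.mul hW)).trace_eq_zero fun h => hne (by linarith)]
    simp
  · exact fun h => absurd hω h

end Expectation

/-! ### Vanishing entropy production equates forward and backward slopes. -/

section Necessity

open scoped ComplexOrder

/-- Dividing by t, √(f t / t) → √a and √(g t / t) → √b, so (√a − √b)² ≤ δc for every δ > 0. -/
theorem eq_of_sq_sqrt_sub_sqrt_le {f g : ℝ → ℝ} {a b c : ℝ} (hf0 : f 0 = 0) (hg0 : g 0 = 0)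
    (hf : HasDerivAt f a 0) (hg : HasDerivAt g b 0) (ha : 0 ≤ a) (hb : 0 ≤ b) (hc : 0 ≤ c)
    (h : ∀ δ > 0, ∀ᶠ t in 𝓝[>] (0 : ℝ), (√(f t) - √(g t)) ^ 2 ≤ δ * t * c) : a = b := by
  have slope : ∀ {k : ℝ → ℝ} {d : ℝ}, k 0 = 0 → HasDerivAt k d 0 →
      Tendsto (fun t => √(k t / t)) (𝓝[>] 0) (𝓝 √d) := by
    intro k d h0 hk
    have h1 := hk.tendsto_slope_zero_right
    simp only [zero_add, h0, sub_zero, smul_eq_mul] at h1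
    exact (Real.continuous_sqrt.tendsto d).comp (h1.congr fun t => by rw [inv_mul_eq_div])
  have hlim := ((slope hf0 hf).sub (slope hg0 hg)).pow 2
  have hle : ∀ δ > 0, (√a - √b) ^ 2 ≤ δ * c := by
    intro δ hδ
    refine le_of_tendsto hlim ?_
    filter_upwards [h δ hδ, self_mem_nhdsWithin] with t ht ht0
    have ht0' : (0 : ℝ) < t := ht0
    rw [Real.sqrt_div' _ ht0'.le, Real.sqrt_div' _ ht0'.le, ← sub_div, div_pow,
      Real.sq_sqrt ht0'.le, div_le_iff₀ ht0']
    linarith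
  have hz : (√a - √b) ^ 2 ≤ 0 := by
    refine le_of_forall_pos_le_add fun δ hδ => ?_
    refine (hle (δ / (c + 1)) (by positivity)).trans ?_
    rw [zero_add, div_mul_eq_mul_div, div_le_iff₀ (by positivity)]
    nlinarith
  have : √a = √b := sub_eq_zero.1 (pow_eq_zero_iff two_ne_zero |>.1 (le_antisymm hz (sq_nonneg _)))
  exact (Real.sqrt_inj ha hb).1 this

theorem eventually_relativeEntropy_le {T : ℝ → Matrix ι ι ℂ →ₗ[ℂ] Matrix ι ι ℂ} {p : ι → ℝ}
    (h : entropyProduction T p = 0) {δ : ℝ} (hδ : 0 < δ) :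
    ∀ᶠ t in 𝓝[>] (0 : ℝ), relativeEntropy (twoPointDensity (forwardState T p t))
      (twoPointDensity (backwardState T p t)) ≤ ((δ * t : ℝ) : EReal) := by
  have hlt : entropyProduction T p < (δ : EReal) := by rw [h]; exact_mod_cast hδ
  filter_upwards [eventually_lt_of_limsup_lt hlt, self_mem_nhdsWithin] with t ht ht0
  have ht0' : (0 : EReal) < (t : EReal) := EReal.coe_pos.2 ht0
  have := (EReal.div_le_iff_le_mul ht0' (EReal.coe_ne_top t)).1 ht.le
  rw [EReal.coe_mul, mul_comm]
  exact this

/-- If the entropy production vanishes, the forward and backward expectations in a vector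
orthogonal to the initial one have the same derivative at time zero. -/
theorem derivative_eq_of_entropyProduction_eq_zero [Nonempty ι]
    {L : Matrix ι ι ℂ →ₗ[ℂ] Matrix ι ι ℂ} (hL : IsLindbladian L) {p : ι → ℝ}
    (h : entropyProduction (semigroup L) p = 0) {W : Matrix ι ι ℂ}
    (hW : trace (sqrtDensity p * W) = 0) {a b : ℝ} (ha : 0 ≤ a) (hb : 0 ≤ b)
    (hWa : choiExpectation p W L = a) (hWb : choiExpectation p Wᵀ L = b) : a = b := by
  have hWt : trace (sqrtDensity p * Wᵀ) = 0 := by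
    rw [← hW, trace_sqrtDensity_mul_eq_sum, trace_sqrtDensity_mul_eq_sum]
    rfl
  have hderiv : ∀ {X : Matrix ι ι ℂ} {d : ℝ}, choiExpectation p X L = d →
      HasDerivAt (fun t => (choiExpectation p X (semigroup L t)).re) d 0 := by
    intro X d hd
    have h1 := hasDerivAt_semigroup L (choiExpectation p X)
    have h2 := Complex.reCLM.hasFDerivAt.comp_hasDerivAt (0 : ℝ) h1
    rw [hd] at h2
    exact h2
  refine eq_of_sq_sqrt_sub_sqrt_le (c := ‖WithLp.toLp 2 fun a : ι × ι => W a.2 a.1‖ ^ 2)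
    ?_ ?_ (hderiv hWa) (hderiv hWb) ha hb (by positivity) fun δ hδ => ?_
  · simp only [semigroup_zero, choiExpectation_one hW, Complex.zero_re]
  · simp only [semigroup_zero, choiExpectation_one hWt, Complex.zero_re]
  · filter_upwards [eventually_relativeEntropy_le h hδ, self_mem_nhdsWithin] with t ht ht0
    have hT := hL.isCompletelyPositive_semigroup (le_of_lt ht0)
    have key := sq_sqrt_expectation_sub_le hT.posSemidef_forwardState
      hT.posSemidef_backwardState (trace_twoPointDensity_forwardState_eq _ p t) ht
      (fun a : ι × ι => W a.2 a.1)
    rwa [expectation_forwardState, expectation_backwardState] at key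

end Necessity

/-! ### The coefficients ν⁻, ν⁺, μ as real sums, and the necessary conditions. -/

section Coefficients

theorem sqrtDensity_mul_self {p : ι → ℝ} (hp : ∀ j, 0 < p j) :
    sqrtDensity p * sqrtDensity p = density p := by
  rw [sqrtDensity, diagonal_mul_diagonal, density]
  congr 1
  ext j
  rw [← Complex.ofReal_mul, Real.mul_self_sqrt (hp j).le]

theorem nuMinus_eq (p : ι → ℝ) (W : Matrix ι ι ℂ) :
    nuMinus p W = ((∑ i, ∑ j, p j * ‖W i j‖ ^ 2 : ℝ) : ℂ) := by
  rw [Finset.sum_comm]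
  push_cast
  refine Finset.sum_congr rfl fun j _ => ?_
  rw [diag_apply, Matrix.mul_apply]
  refine Finset.sum_congr rfl fun i _ => ?_
  rw [density, diagonal_mul, conjTranspose_apply, mul_assoc, mul_comm (star _), Complex.star_def,
    Complex.mul_conj, Complex.normSq_eq_norm_sq]
  push_cast
  rfl

theorem nuPlus_eq (p : ι → ℝ) (W : Matrix ι ι ℂ) :
    nuPlus p W = ((∑ i, ∑ j, p i * ‖W i j‖ ^ 2 : ℝ) : ℂ) := by
  push_cast
  refine Finset.sum_congr rfl fun i _ => ?_
  rw [diag_apply, Matrix.mul_apply]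
  refine Finset.sum_congr rfl fun j _ => ?_
  rw [density, diagonal_mul, conjTranspose_apply, mul_assoc, Complex.star_def,
    Complex.mul_conj, Complex.normSq_eq_norm_sq]
  push_cast
  rfl

theorem mu_eq (p : ι → ℝ) (W : Matrix ι ι ℂ) :
    mu p W = ((∑ i, ∑ j, √(p i) * √(p j) * ‖W i j‖ ^ 2 : ℝ) : ℂ) := by
  rw [mu, trace_sqrtDensity_mul, Finset.sum_comm]
  push_cast
  refine Finset.sum_congr rfl fun i _ => Finset.sum_congr rfl fun j _ => ?_
  rw [conjTranspose_apply]
  have := Complex.mul_conj (W i j)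
  rw [Complex.normSq_eq_norm_sq] at this
  push_cast at this
  rw [← this, Complex.star_def]
  ring

theorem IsRealMatrix.transpose_eq {A : Matrix ι ι ℂ} (hA : IsRealMatrix A) : Aᵀ = Aᴴ := by
  ext i j
  rw [conjTranspose_apply, transpose_apply, Complex.star_def, Complex.conj_eq_iff_im.2 (hA j i)]

end Coefficients

theorem transpose_sqrtDensity (p : ι → ℝ) : (sqrtDensity p)ᵀ = sqrtDensity p :=
  diagonal_transpose _

/-- Both γ²x² and γ'²y² equal γγ'm²; eliminating γ' instead gives x²y² = m⁴. Nonnegativity permits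
taking roots. -/
theorem mul_eq_mul_and_mul_eq_sq {γ γ' x y m : ℝ} (hγ : 0 < γ) (hγ' : 0 < γ') (hx : 0 ≤ x)
    (hy : 0 ≤ y) (h₁ : γ * x ^ 2 = γ' * m ^ 2) (h₂ : γ * m ^ 2 = γ' * y ^ 2) :
    γ * x = γ' * y ∧ x * y = m ^ 2 := by
  constructor
  · refine (sq_eq_sq₀ (by positivity) (by positivity)).1 ?_
    linear_combination γ * h₁ + γ' * h₂
  · refine (sq_eq_sq₀ (by positivity) (by positivity)).1 ?_
    refine mul_left_cancel₀ hγ.ne' ?_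
    linear_combination y ^ 2 * h₁ - m ^ 2 * h₂

/-- The test vectors V_ω ρ^{1/2} and ρ^{1/2} V_ω have degree ω. Since V_ω is real, their transposes
have degree −ω, so the forward slope sees only γ⁻ and the backward slope only γ⁺. -/
theorem detailedBalance_of_entropyProduction_eq_zero [Nonempty ι] {ε : ι → ℝ} {V : Matrix ι ι ℂ}
    {H : ℝ → Matrix ι ι ℂ} {γm γp : ℝ → ℝ} {p : ι → ℝ}
    (hγm : ∀ ω ∈ bohrFrequencies ε, 0 < γm ω) (hγp : ∀ ω ∈ bohrFrequencies ε, 0 < γp ω)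
    (hH : ∀ ω ∈ bohrFrequencies ε, (H ω).IsHermitian)
    (hVreal : ∀ ω ∈ bohrFrequencies ε, IsRealMatrix (bohrComponent ε V ω)) (hp : ∀ j, 0 < p j)
    (h : entropyProduction (semigroup (generator ε V H γm γp)) p = 0) {ω : ℝ}
    (hω : ω ∈ bohrFrequencies ε) :
    (γm ω : ℂ) * nuMinus p (bohrComponent ε V ω) = γp ω * nuPlus p (bohrComponent ε V ω) ∧
      nuMinus p (bohrComponent ε V ω) * nuPlus p (bohrComponent ε V ω) =
        mu p (bohrComponent ε V ω) ^ 2 := by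
  have hL : IsLindbladian (generator ε V H γm γp) := isLindbladian_generator hγm hγp hH
  have hω0 : 0 < ω := (Finset.mem_filter.1 hω).2
  have hm := hγm ω hω
  have hpl := hγp ω hω
  have hs := hasBohrDegree_sqrtDensity ε p
  have hd := hasBohrDegree_bohrComponent ε V ω
  have hT := (hVreal ω hω).transpose_eq
  set W := bohrComponent ε V ω with hWdef
  set s := sqrtDensity p with hsdef
  have hss : s * s = density p := sqrtDensity_mul_self hp
  have d1 : HasBohrDegree ε (W * s) ω := by simpa using hd.mul hs
  have d2 : HasBohrDegree ε (s * W) ω := by simpa using hs.mul hd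
  have d1' : HasBohrDegree ε (W * s)ᵀ (-ω) := by
    rw [transpose_mul, hT, transpose_sqrtDensity]
    simpa using hs.mul hd.conjTranspose
  have d2' : HasBohrDegree ε (s * W)ᵀ (-ω) := by
    rw [transpose_mul, hT, transpose_sqrtDensity]
    simpa using hd.conjTranspose.mul hs
  have z1 : trace (s * (W * s)) = 0 := (hs.mul d1).trace_eq_zero (by linarith)
  have z2 : trace (s * (s * W)) = 0 := (hs.mul d2).trace_eq_zero (by linarith)
  have v1 : trace (s * (Wᴴ * (W * s))) = nuMinus p W := by
    rw [nuMinus, ← hss, ← Matrix.mul_assoc, ← Matrix.mul_assoc, trace_mul_comm]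
    simp only [Matrix.mul_assoc]
  have v2 : trace (s * (W * (W * s)ᵀ)) = mu p W := by
    rw [mu, transpose_mul, hT, transpose_sqrtDensity, ← hsdef, ← Matrix.mul_assoc, trace_mul_comm]
    simp only [Matrix.mul_assoc]
  have v3 : trace (s * (Wᴴ * (s * W))) = mu p W := by
    rw [mu]
    simp only [Matrix.mul_assoc, hsdef]
  have v4 : trace (s * (W * (s * W)ᵀ)) = nuPlus p W := by
    rw [nuPlus, transpose_mul, hT, transpose_sqrtDensity, ← hsdef, ← hss,
      ← Matrix.mul_assoc, ← Matrix.mul_assoc, trace_mul_comm]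
    simp only [Matrix.mul_assoc]
  have e1 := derivative_eq_of_entropyProduction_eq_zero hL h z1
    (mul_nonneg hm.le (sq_nonneg _)) (mul_nonneg hpl.le (sq_nonneg _))
    (choiExpectation_generator_of_degree_pos hω d1 H γm γp)
    (choiExpectation_generator_of_degree_neg hω d1' H γm γp)
  have e2 := derivative_eq_of_entropyProduction_eq_zero hL h z2
    (mul_nonneg hm.le (sq_nonneg _)) (mul_nonneg hpl.le (sq_nonneg _))
    (choiExpectation_generator_of_degree_pos hω d2 H γm γp)
    (choiExpectation_generator_of_degree_neg hω d2' H γm γp)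
  rw [← hWdef, ← hsdef, v1, v2] at e1
  rw [← hWdef, ← hsdef, v3, v4] at e2
  rw [nuMinus_eq, mu_eq] at e1
  rw [nuPlus_eq, mu_eq] at e2
  rw [nuMinus_eq, nuPlus_eq, mu_eq]
  have n1 : 0 ≤ ∑ i, ∑ j, p j * ‖W i j‖ ^ 2 :=
    Finset.sum_nonneg fun i _ => Finset.sum_nonneg fun j _ => mul_nonneg (hp j).le (sq_nonneg _)
  have n2 : 0 ≤ ∑ i, ∑ j, p i * ‖W i j‖ ^ 2 :=
    Finset.sum_nonneg fun i _ => Finset.sum_nonneg fun j _ => mul_nonneg (hp i).le (sq_nonneg _)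
  simp only [Complex.norm_real, Real.norm_eq_abs, sq_abs] at e1 e2
  exact_mod_cast mul_eq_mul_and_mul_eq_sq hm hpl n1 n2 e1 e2

/-! ### Symmetric generators have zero entropy production. -/

section KMSSymmetry

/-- Symmetry of a map for the bilinear form `(x, y) ↦ tr (ρ^{1/2} xᵀ ρ^{1/2} y)`. -/
def IsKMSSymmetric (p : ι → ℝ) (T : Matrix ι ι ℂ →ₗ[ℂ] Matrix ι ι ℂ) : Prop :=
  ∀ x y, trace (sqrtDensity p * xᵀ * sqrtDensity p * T y) =
    trace (sqrtDensity p * (T x)ᵀ * sqrtDensity p * y)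

variable {p : ι → ℝ} {S T : Matrix ι ι ℂ →ₗ[ℂ] Matrix ι ι ℂ}

theorem IsKMSSymmetric.one : IsKMSSymmetric p 1 := fun _ _ => rfl

theorem IsKMSSymmetric.zero : IsKMSSymmetric p 0 := fun _ _ => by simp

theorem IsKMSSymmetric.add (hS : IsKMSSymmetric p S) (hT : IsKMSSymmetric p T) :
    IsKMSSymmetric p (S + T) := fun x y => by
  simp [Matrix.mul_add, Matrix.add_mul, hS x y, hT x y]

theorem IsKMSSymmetric.smul (hT : IsKMSSymmetric p T) (c : ℂ) : IsKMSSymmetric p (c • T) :=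
  fun x y => by simp [hT x y]

theorem IsKMSSymmetric.sub (hS : IsKMSSymmetric p S) (hT : IsKMSSymmetric p T) :
    IsKMSSymmetric p (S - T) := fun x y => by
  simp [Matrix.mul_sub, Matrix.sub_mul, hS x y, hT x y]

theorem IsKMSSymmetric.sum {β : Type*} (s : Finset β)
    {L : β → Matrix ι ι ℂ →ₗ[ℂ] Matrix ι ι ℂ} (hL : ∀ b ∈ s, IsKMSSymmetric p (L b)) :
    IsKMSSymmetric p (∑ b ∈ s, L b) :=
  Finset.sum_induction L (IsKMSSymmetric p) (fun _ _ => IsKMSSymmetric.add) .zero hL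

theorem IsKMSSymmetric.pow (hT : IsKMSSymmetric p T) (n : ℕ) : IsKMSSymmetric p (T ^ n) := by
  induction n with
  | zero => exact .one
  | succ n ih =>
    intro x y
    nth_rewrite 1 [pow_succ]
    rw [pow_succ', Module.End.mul_apply, Module.End.mul_apply, ih, hT]

/-- The functional `T ↦ tr (A * T x)`. -/
def traceApply (A x : Matrix ι ι ℂ) : (Matrix ι ι ℂ →ₗ[ℂ] Matrix ι ι ℂ) →ₗ[ℂ] ℂ :=
  Matrix.traceLinearMap ι ℂ ℂ ∘ₗ LinearMap.mulLeft ℂ A ∘ₗ LinearMap.applyₗ x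

theorem traceApply_apply (A x : Matrix ι ι ℂ) (T : Matrix ι ι ℂ →ₗ[ℂ] Matrix ι ι ℂ) :
    traceApply A x T = trace (A * T x) := rfl

theorem trace_sqrtDensity_transpose_comm (p : ι → ℝ) (x y : Matrix ι ι ℂ) :
    trace (sqrtDensity p * xᵀ * sqrtDensity p * y) =
      trace (sqrtDensity p * yᵀ * sqrtDensity p * x) := by
  rw [← trace_transpose]
  simp only [transpose_mul, transpose_transpose, transpose_sqrtDensity]
  rw [trace_mul_comm]
  simp only [Matrix.mul_assoc]
  rw [trace_mul_comm]
  simp only [Matrix.mul_assoc]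
  rw [trace_mul_comm]
  simp only [Matrix.mul_assoc]

theorem isClosed_isKMSSymmetric (p : ι → ℝ) :
    IsClosed {A : Matrix (ι × ι) (ι × ι) ℂ | IsKMSSymmetric p (mapOfMatrix A)} := by
  have h : {A : Matrix (ι × ι) (ι × ι) ℂ | IsKMSSymmetric p (mapOfMatrix A)} =
      ⋂ x : Matrix ι ι ℂ, ⋂ y : Matrix ι ι ℂ,
        {A | traceApply (sqrtDensity p * xᵀ * sqrtDensity p) y (mapOfMatrix A) =
          traceApply (sqrtDensity p * yᵀ * sqrtDensity p) x (mapOfMatrix A)} := by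
    ext A
    simp only [Set.mem_iInter, Set.mem_ofPred_eq, traceApply_apply, IsKMSSymmetric]
    refine forall_congr' fun x => forall_congr' fun y => ?_
    -- Symmetry of the form moves the map to the last factor on both sides, giving an equation
    -- linear in `A`.
    rw [trace_sqrtDensity_transpose_comm p (mapOfMatrix A x)]
  rw [h]
  exact isClosed_iInter fun x => isClosed_iInter fun y =>
    isClosed_eq (continuous_mapOfMatrix_apply _) (continuous_mapOfMatrix_apply _)

theorem IsKMSSymmetric.semigroup [Nonempty ι] {L : Matrix ι ι ℂ →ₗ[ℂ] Matrix ι ι ℂ}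
    (hL : IsKMSSymmetric p L) {t : ℝ} (ht : 0 ≤ t) : IsKMSSymmetric p (semigroup L t) :=
  semigroup_induction L 0 _ (isClosed_isKMSSymmetric p)
    (fun s _ n => ((IsKMSSymmetric.one.add (hL.smul s)).add (IsKMSSymmetric.zero.smul _)).pow n)
    t ht

/-- Symmetry of the semigroup says precisely that the forward and backward states agree for t ≥ 0.
-/
theorem entropyProduction_eq_zero_of_isKMSSymmetric [Nonempty ι]
    {L : Matrix ι ι ℂ →ₗ[ℂ] Matrix ι ι ℂ} (hL : IsKMSSymmetric p L) :
    entropyProduction (StochasticLimit.semigroup L) p = 0 := by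
  have h : ∀ᶠ t in 𝓝[>] (0 : ℝ),
      relativeEntropy (twoPointDensity (forwardState (StochasticLimit.semigroup L) p t))
        (twoPointDensity (backwardState (StochasticLimit.semigroup L) p t)) / (t : EReal) = 0 := by
    filter_upwards [self_mem_nhdsWithin] with t ht
    have e : forwardState (StochasticLimit.semigroup L) p t =
        backwardState (StochasticLimit.semigroup L) p t :=
      LinearMap.ext fun x => LinearMap.ext fun y => hL.semigroup (le_of_lt ht) x y
    rw [e, relativeEntropy_self, EReal.zero_div]
  rw [entropyProduction, limsup_congr h, limsup_const]

theorem isKMSSymmetric_sandwich_one {M : Matrix ι ι ℂ} (hM : Mᵀ = M)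
    (hc : M * sqrtDensity p = sqrtDensity p * M) : IsKMSSymmetric p (sandwich M 1) := by
  intro x y
  simp only [sandwich_apply, Matrix.mul_one, transpose_mul, hM, Matrix.mul_assoc]
  rw [← Matrix.mul_assoc M, hc]
  simp only [Matrix.mul_assoc]

theorem isKMSSymmetric_one_sandwich {M : Matrix ι ι ℂ} (hM : Mᵀ = M)
    (hc : M * sqrtDensity p = sqrtDensity p * M) : IsKMSSymmetric p (sandwich 1 M) := by
  intro x y
  simp only [sandwich_apply, Matrix.one_mul, transpose_mul, hM]
  rw [← Matrix.mul_assoc, ← Matrix.mul_assoc, trace_mul_comm]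
  simp only [← Matrix.mul_assoc]
  rw [hc]

end KMSSymmetry

/-! ### Detailed balance and symmetry of the dissipative part. -/

section DetailedBalance

variable {p : ι → ℝ} {W : Matrix ι ι ℂ} {a b : ℝ}

theorem smul_sqrtDensity_mul_conjTranspose
    (hW : (a : ℂ) • (W * sqrtDensity p) = (b : ℂ) • (sqrtDensity p * W)) :
    (a : ℂ) • (sqrtDensity p * Wᴴ) = (b : ℂ) • (Wᴴ * sqrtDensity p) := by
  have hs : (sqrtDensity p)ᴴ = sqrtDensity p := by
    simp [sqrtDensity, diagonal_conjTranspose, Pi.star_def]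
  have h := congrArg Matrix.conjTranspose hW
  simpa [conjTranspose_smul, hs] using h

/-- Moving ρ^{1/2} leftwards through W costs b/a and through W* costs a/b; the factors cancel. -/
theorem conjTranspose_mul_self_comm_sqrtDensity (ha : a ≠ 0)
    (hW : (a : ℂ) • (W * sqrtDensity p) = (b : ℂ) • (sqrtDensity p * W)) :
    Wᴴ * W * sqrtDensity p = sqrtDensity p * (Wᴴ * W) := by
  have hW' := smul_sqrtDensity_mul_conjTranspose hW
  refine smul_right_injective _ (Complex.ofReal_ne_zero.2 ha) ?_
  change (a : ℂ) • (Wᴴ * W * sqrtDensity p) = (a : ℂ) • (sqrtDensity p * (Wᴴ * W))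
  rw [Matrix.mul_assoc, ← Matrix.mul_smul, hW, ← Matrix.mul_assoc (sqrtDensity p),
    ← Matrix.smul_mul _ (sqrtDensity p * Wᴴ), hW', Matrix.mul_smul, Matrix.smul_mul, Matrix.mul_assoc]

theorem self_mul_conjTranspose_comm_sqrtDensity (hb : b ≠ 0)
    (hW : (a : ℂ) • (W * sqrtDensity p) = (b : ℂ) • (sqrtDensity p * W)) :
    W * Wᴴ * sqrtDensity p = sqrtDensity p * (W * Wᴴ) := by
  have hW' := smul_sqrtDensity_mul_conjTranspose hW
  refine smul_right_injective _ (Complex.ofReal_ne_zero.2 hb) ?_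
  change (b : ℂ) • (W * Wᴴ * sqrtDensity p) = (b : ℂ) • (sqrtDensity p * (W * Wᴴ))
  rw [Matrix.mul_assoc, ← Matrix.mul_smul, ← hW', ← Matrix.mul_assoc (sqrtDensity p),
    ← Matrix.smul_mul _ (sqrtDensity p * W), ← hW, Matrix.mul_smul, Matrix.smul_mul, Matrix.mul_assoc]

/-- Up to the ratio of rates, the two jump maps are adjoint to each other for the form, so their
weighted sum is symmetric. -/
theorem trace_sandwich_balance (hT : Wᵀ = Wᴴ)
    (hW : (a : ℂ) • (W * sqrtDensity p) = (b : ℂ) • (sqrtDensity p * W)) (x y : Matrix ι ι ℂ) :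
    (a : ℂ) ^ 2 * trace (sqrtDensity p * xᵀ * sqrtDensity p * (Wᴴ * y * W)) =
      (b : ℂ) ^ 2 * trace (sqrtDensity p * (W * x * Wᴴ)ᵀ * sqrtDensity p * y) := by
  have hW' := smul_sqrtDensity_mul_conjTranspose hW
  have hT' : Wᴴᵀ = W := by rw [← hT, transpose_transpose]
  have e1 : (a : ℂ) ^ 2 * trace (sqrtDensity p * xᵀ * sqrtDensity p * (Wᴴ * y * W)) =
      trace (((a : ℂ) • (W * sqrtDensity p)) * xᵀ * ((a : ℂ) • (sqrtDensity p * Wᴴ)) * y) := by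
    rw [← Matrix.mul_assoc, trace_mul_comm]
    simp only [Matrix.smul_mul, Matrix.mul_smul, trace_smul, smul_eq_mul, Matrix.mul_assoc]
    ring
  rw [e1, hW, hW', transpose_mul, transpose_mul, hT, hT']
  simp only [Matrix.smul_mul, Matrix.mul_smul, trace_smul, smul_eq_mul, Matrix.mul_assoc]
  ring

theorem isKMSSymmetric_localGenerator_zero (ha : a ≠ 0) (hb : b ≠ 0) (hT : Wᵀ = Wᴴ)
    (hW : (a : ℂ) • (W * sqrtDensity p) = (b : ℂ) • (sqrtDensity p * W)) :
    IsKMSSymmetric p (localGenerator 0 W (a ^ 2) (b ^ 2)) := by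
  have hT' : Wᴴᵀ = W := by rw [← hT, transpose_transpose]
  have hm : (Wᴴ * W)ᵀ = Wᴴ * W := by rw [transpose_mul, hT, hT']
  have hp : (W * Wᴴ)ᵀ = W * Wᴴ := by rw [transpose_mul, hT, hT']
  have cm := conjTranspose_mul_self_comm_sqrtDensity ha hW
  have cp := self_mul_conjTranspose_comm_sqrtDensity hb hW
  have hjump : IsKMSSymmetric p
      (((a ^ 2 : ℝ) : ℂ) • sandwich Wᴴ W + ((b ^ 2 : ℝ) : ℂ) • sandwich W Wᴴ) := by
    intro x y
    have h1 := trace_sandwich_balance hT hW x y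
    have h2 := trace_sandwich_balance hT hW y x
    rw [trace_sqrtDensity_transpose_comm, trace_sqrtDensity_transpose_comm p (W * y * Wᴴ)] at h2
    simp only [LinearMap.add_apply, LinearMap.smul_apply, sandwich_apply, transpose_add,
      transpose_smul, Matrix.mul_add, Matrix.add_mul, Matrix.mul_smul, Matrix.smul_mul, trace_add,
      trace_smul, smul_eq_mul, Complex.ofReal_pow]
    linear_combination h1 - h2
  have e : localGenerator 0 W (a ^ 2) (b ^ 2) =
      (((a ^ 2 : ℝ) : ℂ) • sandwich Wᴴ W + ((b ^ 2 : ℝ) : ℂ) • sandwich W Wᴴ)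
      - (((a ^ 2 : ℝ) : ℂ) / 2) • (sandwich (Wᴴ * W) 1 + sandwich 1 (Wᴴ * W))
      - (((b ^ 2 : ℝ) : ℂ) / 2) • (sandwich (W * Wᴴ) 1 + sandwich 1 (W * Wᴴ)) := by
    refine LinearMap.ext fun x => ?_
    simp only [localGenerator, LinearMap.coe_mk, AddHom.coe_mk, LinearMap.sub_apply,
      LinearMap.add_apply, LinearMap.smul_apply, sandwich_apply, Matrix.mul_one, Matrix.one_mul,
      Matrix.zero_mul, Matrix.mul_zero]
    module
  rw [e]
  exact (hjump.sub (((isKMSSymmetric_sandwich_one hm cm).add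
    (isKMSSymmetric_one_sandwich hm cm)).smul _)).sub
    (((isKMSSymmetric_sandwich_one hp cp).add (isKMSSymmetric_one_sandwich hp cp)).smul _)

theorem localGenerator_zero_apply_one (W : Matrix ι ι ℂ) (γm γp : ℝ) :
    localGenerator 0 W γm γp 1 = 0 := by
  simp only [localGenerator, LinearMap.coe_mk, AddHom.coe_mk, Matrix.mul_one, Matrix.one_mul]
  module

/-- Pairing with the identity: symmetry moves `T` onto 1, where it vanishes. -/
theorem IsKMSSymmetric.trace_density_mul (hp : ∀ j, 0 < p j)
    {T : Matrix ι ι ℂ →ₗ[ℂ] Matrix ι ι ℂ} (hT : IsKMSSymmetric p T) (h1 : T 1 = 0)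
    (x : Matrix ι ι ℂ) : trace (density p * T x) = 0 := by
  have h := hT 1 x
  simpa [h1, sqrtDensity_mul_self hp] using h

/-- The scalar conditions of the theorem amount to a detailed balance relation. -/
theorem smul_mul_sqrtDensity_eq {γm γp : ℝ} (hγm : 0 < γm) (hγp : 0 < γp) (hp : ∀ j, 0 < p j)
    (h1 : (γm : ℂ) * nuMinus p W = γp * nuPlus p W)
    (h2 : nuMinus p W * nuPlus p W = mu p W ^ 2) :
    ((√γm : ℝ) : ℂ) • (W * sqrtDensity p) = ((√γp : ℝ) : ℂ) • (sqrtDensity p * W) := by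
  rw [nuMinus_eq, nuPlus_eq] at h1
  rw [nuMinus_eq, nuPlus_eq, mu_eq] at h2
  norm_cast at h1 h2
  have hx : 0 ≤ ∑ i, ∑ j, p j * ‖W i j‖ ^ 2 :=
    Finset.sum_nonneg fun i _ => Finset.sum_nonneg fun j _ => mul_nonneg (hp j).le (sq_nonneg _)
  have hm : 0 ≤ ∑ i, ∑ j, √(p i) * √(p j) * ‖W i j‖ ^ 2 :=
    Finset.sum_nonneg fun i _ => Finset.sum_nonneg fun j _ => by positivity
  -- The sum is γ⁻ν⁻ + γ⁺ν⁺ − 2√(γ⁻γ⁺)μ; under the hypotheses both γ⁻ν⁻ and γ⁺ν⁺ equal √(γ⁻γ⁺)μ, so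
  -- each nonnegative term vanishes.
  have hsum : ∑ i, ∑ j, ‖W i j‖ ^ 2 * (√γm * √(p j) - √γp * √(p i)) ^ 2 =
      γm * (∑ i, ∑ j, p j * ‖W i j‖ ^ 2) + γp * (∑ i, ∑ j, p i * ‖W i j‖ ^ 2) -
        2 * (√γm * √γp) * ∑ i, ∑ j, √(p i) * √(p j) * ‖W i j‖ ^ 2 := by
    simp only [Finset.mul_sum, ← Finset.sum_add_distrib, ← Finset.sum_sub_distrib]
    refine Finset.sum_congr rfl fun i _ => Finset.sum_congr rfl fun j _ => ?_
    have q1 := Real.sq_sqrt hγm.le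
    have q2 := Real.sq_sqrt hγp.le
    have q3 := Real.sq_sqrt (hp i).le
    have q4 := Real.sq_sqrt (hp j).le
    rw [sub_sq, mul_pow, mul_pow, q1, q2, q3, q4]
    ring
  have hzero : ∑ i, ∑ j, ‖W i j‖ ^ 2 * (√γm * √(p j) - √γp * √(p i)) ^ 2 = 0 := by
    rw [hsum]
    generalize (∑ i, ∑ j, p j * ‖W i j‖ ^ 2) = x at *
    generalize (∑ i, ∑ j, p i * ‖W i j‖ ^ 2) = y at *
    generalize (∑ i, ∑ j, √(p i) * √(p j) * ‖W i j‖ ^ 2) = m at *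
    have : γm * x = √γm * √γp * m := by
      refine (sq_eq_sq₀ (by positivity) (by positivity)).1 ?_
      rw [mul_pow (√γm * √γp), mul_pow (√γm), Real.sq_sqrt hγm.le, Real.sq_sqrt hγp.le]
      linear_combination γm * x * h1 + γm * γp * h2
    linarith
  have hent : ∀ i j, ‖W i j‖ ^ 2 * (√γm * √(p j) - √γp * √(p i)) ^ 2 = 0 := by
    intro i j
    have h := (Finset.sum_eq_zero_iff_of_nonneg fun i _ =>
      Finset.sum_nonneg fun j _ => by positivity).1 hzero i (Finset.mem_univ _)
    exact (Finset.sum_eq_zero_iff_of_nonneg fun j _ => by positivity).1 h j (Finset.mem_univ _)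
  ext i j
  simp only [Matrix.smul_apply, sqrtDensity, mul_diagonal, diagonal_mul, smul_eq_mul]
  rcases mul_eq_zero.1 (hent i j) with h | h
  · have : W i j = 0 := by simpa using h
    simp [this]
  · have h3 : √γm * √(p j) = √γp * √(p i) := sub_eq_zero.1 (by simpa using h)
    have h4 : ((√γm : ℝ) : ℂ) * ((√(p j) : ℝ) : ℂ) = (√γp : ℝ) * (√(p i) : ℝ) := by
      exact_mod_cast h3
    linear_combination W i j * h4

end DetailedBalance

/-! ### Symmetry of the full generator. -/

section Sufficiency

/-- Invariance is known only for t ≥ 0, hence the one-sided derivative at 0. -/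
theorem IsInvariant.trace_density_mul {L : Matrix ι ι ℂ →ₗ[ℂ] Matrix ι ι ℂ} {p : ι → ℝ}
    (h : IsInvariant (semigroup L) p) (x : Matrix ι ι ℂ) : trace (density p * L x) = 0 := by
  have h1 := (hasDerivAt_semigroup L (traceApply (density p) x)).hasDerivWithinAt
    (s := Set.Ici 0)
  have h2 : HasDerivWithinAt (fun t : ℝ => traceApply (density p) x (semigroup L t)) 0
      (Set.Ici 0) 0 :=
    (hasDerivWithinAt_const (0 : ℝ) _ (trace (density p * x))).congr
      (fun t ht => h t ht x) (h 0 le_rfl x)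
  exact (uniqueDiffWithinAt_Ici (0 : ℝ)).eq_deriv _ h1 h2

theorem mul_sqrtDensity_comm_of_density_comm {p : ι → ℝ} {H : Matrix ι ι ℂ}
    (h : H * density p = density p * H) : H * sqrtDensity p = sqrtDensity p * H := by
  ext i j
  have hij := congrFun (congrFun h i) j
  simp only [density, mul_diagonal, diagonal_mul] at hij
  simp only [sqrtDensity, mul_diagonal, diagonal_mul]
  by_cases h0 : H i j = 0
  · simp [h0]
  · have h1 : p j = p i := by
      rw [mul_comm] at hij
      exact_mod_cast mul_right_cancel₀ h0 hij
    rw [h1, mul_comm]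

/-- Collecting the Hamiltonians matters because invariance controls only their sum. -/
theorem generator_eq (ε : ι → ℝ) (V : Matrix ι ι ℂ) (H : ℝ → Matrix ι ι ℂ) (γm γp : ℝ → ℝ) :
    generator ε V H γm γp =
      Complex.I • (sandwich (∑ ω ∈ bohrFrequencies ε, H ω) 1 -
        sandwich 1 (∑ ω ∈ bohrFrequencies ε, H ω)) +
      ∑ ω ∈ bohrFrequencies ε, localGenerator 0 (bohrComponent ε V ω) (γm ω) (γp ω) := by
  refine LinearMap.ext fun x => ?_
  simp only [generator, LinearMap.add_apply, LinearMap.smul_apply, LinearMap.sub_apply,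
    LinearMap.sum_apply, sandwich_apply, Matrix.mul_one, Matrix.one_mul, Finset.sum_mul,
    Finset.mul_sum, ← Finset.sum_sub_distrib, Finset.smul_sum, ← Finset.sum_add_distrib]
  refine Finset.sum_congr rfl fun ω _ => ?_
  simp only [localGenerator, LinearMap.coe_mk, AddHom.coe_mk, Matrix.zero_mul, Matrix.mul_zero]
  module

theorem isKMSSymmetric_generator {ε : ι → ℝ} {V : Matrix ι ι ℂ}
    {H : ℝ → Matrix ι ι ℂ} {γm γp : ℝ → ℝ} {p : ι → ℝ}
    (hγm : ∀ ω ∈ bohrFrequencies ε, 0 < γm ω) (hγp : ∀ ω ∈ bohrFrequencies ε, 0 < γp ω)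
    (hH : ∀ ω ∈ bohrFrequencies ε, (H ω).IsHermitian)
    (hHreal : ∀ ω ∈ bohrFrequencies ε, IsRealMatrix (H ω))
    (hVreal : ∀ ω ∈ bohrFrequencies ε, IsRealMatrix (bohrComponent ε V ω)) (hp : ∀ j, 0 < p j)
    (hinv : IsInvariant (semigroup (generator ε V H γm γp)) p)
    (h : ∀ ω ∈ bohrFrequencies ε,
      (γm ω : ℂ) * nuMinus p (bohrComponent ε V ω) = γp ω * nuPlus p (bohrComponent ε V ω) ∧
      nuMinus p (bohrComponent ε V ω) * nuPlus p (bohrComponent ε V ω) =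
        mu p (bohrComponent ε V ω) ^ 2) :
    IsKMSSymmetric p (generator ε V H γm γp) := by
  have hD : ∀ ω ∈ bohrFrequencies ε,
      IsKMSSymmetric p (localGenerator 0 (bohrComponent ε V ω) (γm ω) (γp ω)) := by
    intro ω hω
    have hm := hγm ω hω
    have hpl := hγp ω hω
    have key := isKMSSymmetric_localGenerator_zero (Real.sqrt_pos.2 hm).ne'
      (Real.sqrt_pos.2 hpl).ne' (hVreal ω hω).transpose_eq
      (smul_mul_sqrtDensity_eq hm hpl hp (h ω hω).1 (h ω hω).2)
    rwa [Real.sq_sqrt hm.le, Real.sq_sqrt hpl.le] at key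
  set K := ∑ ω ∈ bohrFrequencies ε, H ω with hK
  have hKt : Kᵀ = K := by
    rw [hK, transpose_sum]
    refine Finset.sum_congr rfl fun ω hω => ?_
    rw [(hHreal ω hω).transpose_eq, (hH ω hω).eq]
  -- The symmetric dissipative part already annihilates ρ, so invariance reduces to tr(ρ[K,x]) = 0
  -- for all x.
  have hcomm : K * density p = density p * K := by
    refine Matrix.ext_iff_trace_mul_right.2 fun x => ?_
    have h0 := hinv.trace_density_mul x
    have hz : trace (density p * (∑ ω ∈ bohrFrequencies ε,
        localGenerator 0 (bohrComponent ε V ω) (γm ω) (γp ω)) x) = 0 :=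
      (IsKMSSymmetric.sum _ hD).trace_density_mul hp (by
        rw [LinearMap.sum_apply]
        exact Finset.sum_eq_zero fun ω _ => localGenerator_zero_apply_one _ _ _) x
    rw [generator_eq, LinearMap.add_apply, Matrix.mul_add, trace_add, hz, add_zero,
      LinearMap.smul_apply, Matrix.mul_smul, trace_smul, smul_eq_mul] at h0
    have h1 := (mul_eq_zero.1 h0).resolve_left Complex.I_ne_zero
    rw [LinearMap.sub_apply, sandwich_apply, sandwich_apply, Matrix.mul_one, Matrix.one_mul,
      Matrix.mul_sub, trace_sub, sub_eq_zero, ← hK] at h1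
    rw [Matrix.mul_assoc (density p), h1, ← Matrix.mul_assoc, trace_mul_comm _ K,
      Matrix.mul_assoc]
  have hc := mul_sqrtDensity_comm_of_density_comm hcomm
  rw [generator_eq]
  exact (((isKMSSymmetric_sandwich_one hKt hc).sub
    (isKMSSymmetric_one_sandwich hKt hc)).smul _).add (.sum _ hD)

end Sufficiency

end StochasticLimit

end

theorem mainTheorem2 {ι : Type*} [Fintype ι] [DecidableEq ι]
    (ε : ι → ℝ) (V : Matrix ι ι ℂ) (H : ℝ → Matrix ι ι ℂ) (γm γp : ℝ → ℝ) (p : ι → ℝ)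
    (hγm : ∀ ω ∈ StochasticLimit.bohrFrequencies ε, 0 < γm ω)
    (hγp : ∀ ω ∈ StochasticLimit.bohrFrequencies ε, 0 < γp ω)
    (hH : ∀ ω ∈ StochasticLimit.bohrFrequencies ε, (H ω).IsHermitian)
    (hHS : ∀ ω ∈ StochasticLimit.bohrFrequencies ε,
      Commute (H ω) (StochasticLimit.systemHamiltonian ε))
    (hHreal : ∀ ω ∈ StochasticLimit.bohrFrequencies ε, StochasticLimit.IsRealMatrix (H ω))
    (hVreal : ∀ ω ∈ StochasticLimit.bohrFrequencies ε,
      StochasticLimit.IsRealMatrix (StochasticLimit.bohrComponent ε V ω))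
    (hp : ∀ j, 0 < p j) (hp1 : ∑ j, p j = 1)
    (hinv : StochasticLimit.IsInvariant
      (StochasticLimit.semigroup (StochasticLimit.generator ε V H γm γp)) p) :
    StochasticLimit.entropyProduction
        (StochasticLimit.semigroup (StochasticLimit.generator ε V H γm γp)) p = 0 ↔
      ∀ ω ∈ StochasticLimit.bohrFrequencies ε,
        (γm ω : ℂ) * StochasticLimit.nuMinus p (StochasticLimit.bohrComponent ε V ω) =
            (γp ω : ℂ) * StochasticLimit.nuPlus p (StochasticLimit.bohrComponent ε V ω) ∧
          StochasticLimit.nuMinus p (StochasticLimit.bohrComponent ε V ω) *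
              StochasticLimit.nuPlus p (StochasticLimit.bohrComponent ε V ω) =
            StochasticLimit.mu p (StochasticLimit.bohrComponent ε V ω) ^ 2 := by
  -- Needed for ‖1‖ = 1 in the product formula; Σ p_j = 1 excludes the empty index type.
  have hne : Nonempty ι := by
    by_contra hempty
    rw [not_nonempty_iff] at hempty
    simp at hp1
  exact ⟨fun h ω hω => StochasticLimit.detailedBalance_of_entropyProduction_eq_zero hγm hγp hH
      hVreal hp h hω,
    fun h => StochasticLimit.entropyProduction_eq_zero_of_isKMSSymmetric
      (StochasticLimit.isKMSSymmetric_generator hγm hγp hH hHreal hVreal hp hinv h)⟩
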